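/- Let $\mathfrak g$ be one of the basic Lie superalgebras $psl(2|2)$, $spo(2|2r)$ with $r\ge 3$, $D(2,1;\frac mn)$ with $m,n$ coprime positive integers, $F(4)$, with highest root $\theta$ of the minimal gradation and invariant form normalized by $(\theta|\theta)=2$. Let $\mathfrak g^\natural=\bigoplus_i\mathfrak g^\natural_i$ be the centralizer of the corresponding $sl(2)$, equal to $sl(2)$, $so(2r)$, $sl(2)\oplus sl(2)$, $so(7)$ respectively, decomposed into simple ideals, with Cartan subalgebra $\mathfrak h^\natural$, root system $\Delta^\natural$, the standard positive roots $\Delta^\natural_+$ and highest roots $\theta^\natural_i$. In orthogonal coordinates these data are: - $psl(2|2)$: $\Delta^\natural_+=\{2\epsilon\}$, $(\epsilon|\epsilon)=-\frac12$ (where $2\epsilon=\delta_1-\delta_2$); weights of $\mathfrak g_{-1/2}$: $\pm\epsilon$; $\rho_R=\omega^1_1=\epsilon$; $h^\vee=0$, $p(k)=k(k+1)$; - $spo(2|2r)$: $\Delta^\natural_+=\{\epsilon_a\pm\epsilon_b: a<b\}$, $(\epsilon_a|\epsilon_a)=-\frac12$; weights of $\mathfrak g_{-1/2}$: $\pm\epsilon_a$;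 $\rho_R=\omega^1_r=\frac12\sum_a\epsilon_a$ or $\rho_R=\omega^1_{r-1}=\omega^1_r-\epsilon_r$; $h^\vee=2-r$, $p(k)=(k+\frac12)(k+\frac{3-r}2)$; - $D(2,1;\frac mn)$: $\Delta^\natural_+=\{2\epsilon_2,2\epsilon_3\}$, $(\epsilon_2|\epsilon_2)=-\frac n{2(m+n)}$, $(\epsilon_3|\epsilon_3)=-\frac m{2(m+n)}$; weights of $\mathfrak g_{-1/2}$: $\pm\epsilon_2\pm\epsilon_3$; $\rho_R=\omega^1_1=\epsilon_2$ or $\rho_R=\omega^2_1=\epsilon_3$; $h^\vee=0$, $p(k)=(k+\frac m{m+n})(k+\frac n{m+n})$; - $F(4)$: $\Delta^\natural_+=\{\epsilon_a\pm\epsilon_b:a<b\}\cup\{\epsilon_a\}$, $1\le a,b\le3$, $(\epsilon_a|\epsilon_a)=-\frac23$; weights of $\mathfrak g_{-1/2}$: $\frac12(\pm\epsilon_1\pm\epsilon_2\pm\epsilon_3)$; $\rho_R=\omega^1_1=\epsilon_1$; $h^\vee=-2$, $p(k)=(k+\frac23)(k-\frac23)$. Put $M_i(k)=\frac{2k}{(\theta^\natural_i|\theta^\natural_i)}-1$,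 and let $k\in\mathbb R$ be such that all $M_i(k)$ are non-negative integers (this holds for every $k$ in the unitary range of the minimal $W$-algebra $W^{\min}_k(\mathfrak g)$). Fix $\rho_R$ from the list, let $i$ be the index of the simple ideal of which $\rho_R$ is a fundamental weight, and put $h^R=4\rho_R/(\theta^\natural_i|\theta^\natural_i)\in\mathfrak h^\natural$, identifying $\mathfrak h^\natural$ with its dual by the form. Let $\Delta^{NS}_+=\{\alpha\in\Delta^\natural:\alpha(h^R)<0\}\cup\{\alpha\in\Delta^\natural_+:\alpha(h^R)=0\}$, again a positive system. Let $P^k_+(R)$ (resp. $P^k_+(NS)$) be the set of weights $\nu$ of $\mathfrak h^\natural$ that are dominant integral for $\Delta^\natural_+$ (resp. $\Delta^{NS}_+$) and satisfy $\nu(\theta_j^\vee)\le M_j(k)$ for all $j$, where $\theta_j$ is the highest root of $\mathfrak g^\natural_j$ for $\Delta^\natural_+$ (resp. $\Delta^{NS}_+$). Set $$A^{NS}(k,\nu)=\frac{(\nu|\nu+2\rho^{NS})}{2(k+h^\vee)}+\frac{(\xi|\nu)}{k+h^\vee}\bigl((\xi|\nu)-k-1\bigr),$$ where $2\rho^{NS}=\sum_{\alpha\in\Delta^{NS}_+}\alpha$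 and $\xi$ is the highest weight of $\mathfrak g_{-1/2}$ for $\Delta^{NS}_+$, and $$A^{R}(k,\nu)=\frac{(\nu|\nu+2\rho^\natural-2\rho_R)+2(\nu|\eta)(\nu+2\rho^\natural-2\rho_R|\eta)-\frac12p(k)}{2(k+h^\vee)},$$ where $2\rho^\natural=\sum_{\alpha\in\Delta^\natural_+}\alpha$ and $\eta$ is the minimal one, with respect to $\Delta^\natural_+$, among the weights of $\mathfrak g_{-1/2}$ that are positive on $h^R$. Then for every $\nu\in P^k_+(NS)$ the weight $\nu^R=\nu+M_i(k)\rho_R$ lies in $P^k_+(R)$, and $$A^{NS}(k,\nu)+\frac{2}{(\theta^\natural_i|\theta^\natural_i)}(\nu|\rho_R)+\frac{1}{(\theta^\natural_i|\theta^\natural_i)}M_i(k)(\rho_R|\rho_R)=A^R(k,\nu^R).$$ -/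

import Mathlib

/-! Root-theoretic data of the basic Lie superalgebras `psl(2|2)`, `spo(2|2r)`, `D(2,1;m/n)`, `F(4)`
relative to their minimal gradation, and the weight sets and conformal-weight bounds attached to the
minimal `W`-algebra of level `k` in the Neveu-Schwarz and Ramond sectors. -/

noncomputable section

namespace MinimalW

/-- The Lie superalgebras under consideration. In the family `D(2,1;m/n)` the integers `m`, `n` are
positive and coprime; `spo(2|2r)` is taken with `r > 2`, as `spo(2|4) = D(2,1;1)`. -/
inductive Superalgebra : Type
  | psl22 : Superalgebra
  | spo (r : ℕ) (hr : 3 ≤ r) : Superalgebra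
  | D21 (m n : ℕ) (hm : 0 < m) (hn : 0 < n) (hmn : m.Coprime n) : Superalgebra
  | F4 : Superalgebra

/-- The combinatorial data of a pair `(𝔤, θ)`, where `θ` is the highest root of the minimal gradation
and the invariant form is normalized by `(θ|θ) = 2`. The real span of the weights of `𝔥♮` is identified
with `Fin n → ℝ` by means of an orthogonal basis `ε`. (All the weights that are integral for `𝔤♮` lie in
this real span.) It is only used through the explicit values `Superalgebra.data` below. -/
structure RootData where
  /-- rank of `𝔤♮` -/
  n : ℕ
  /-- number of simple ideals of `𝔤♮` -/
  s : ℕ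
  /-- the numbers `(ε_a|ε_a)` -/
  sq : Fin n → ℝ
  /-- the positive roots of the simple ideal `𝔤♮_i` -/
  pos : Fin s → Set (Fin n → ℝ)
  /-- the `𝔥♮`-weights of `𝔤_{-1/2}` -/
  halfWeights : Set (Fin n → ℝ)
  /-- the dual Coxeter number `h^∨` of `𝔤` -/
  hDual : ℝ
  /-- the monic quadratic polynomial `p(k)` in the `λ`-bracket of the odd generators `G^{v}` -/
  p : ℝ → ℝ
  /-- the pairs `(i, ρ_R)`, with `ρ_R = ω^i_j` a fundamental weight of `𝔤♮_i`, that are allowed -/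
  rhoR : Set (Fin s × (Fin n → ℝ))

/-- The basis vector `ε_a`. -/
def e {n : ℕ} (a : Fin n) : Fin n → ℝ := Pi.single a 1

/-- The positive roots `ε_a ± ε_b`, `a < b`, of `so(2r)`. -/
def posD (r : ℕ) : Set (Fin r → ℝ) :=
  {α | ∃ a b : Fin r, a < b ∧ (α = e a + e b ∨ α = e a - e b)}

/-- The positive roots `ε_a ± ε_b`, `a < b`, and `ε_a` of `so(2r+1)`. -/
def posB (r : ℕ) : Set (Fin r → ℝ) :=
  posD r ∪ {α | ∃ a : Fin r, α = e a}

/-- * `psl(2|2)`: `𝔤♮ = sl(2)` with positive root `δ₁ - δ₂ = 2ε`, where `ε = (δ₁ - δ₂)/2` and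
  `(δ_i|δ_j) = -δ_ij`; the weights of `𝔤_{-1/2}` are `±ε` (each of multiplicity two), `ρ_R = ω_1 = ε`.
* `spo(2|2r)`: `𝔤♮ = so(2r)`, `𝔤_{-1/2} = ℂ^{2r}`, `ρ_R = ω_r = (ε_1 + ⋯ + ε_r)/2` or
  `ρ_R = ω_{r-1} = (ε_1 + ⋯ + ε_{r-1} - ε_r)/2`.
* `D(2,1;m/n)`: `𝔤♮ = sl(2) × sl(2)` with positive roots `2ε_2` and `2ε_3` (here `e 0 = ε_2` and
  `e 1 = ε_3`), `𝔤_{-1/2} = ℂ² ⊗ ℂ²`, `ρ_R = ω_1^1 = ε_2` or `ρ_R = ω_1^2 = ε_3`.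
* `F(4)`: `𝔤♮ = so(7)`, `𝔤_{-1/2}` is the spin representation, `ρ_R = ω_1 = ε_1`. -/
def Superalgebra.data : Superalgebra → RootData
  | .psl22 =>
    { n := 1
      s := 1
      sq := fun _ => -1 / 2
      pos := fun _ => {(2 : ℝ) • e 0}
      halfWeights := {e 0, -e 0}
      hDual := 0
      p := fun k => k * (k + 1)
      rhoR := {(0, e 0)} }
  | .spo r hr =>
    { n := r
      s := 1
      sq := fun _ => -1 / 2
      pos := fun _ => posD r
      halfWeights := {η | ∃ a : Fin r, η = e a ∨ η = -e a}
      hDual := 2 - r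
      p := fun k => (k + 1 / 2) * (k + (3 - r) / 2)
      rhoR := {(0, fun _ => 1 / 2),
        (0, (fun _ => 1 / 2) - e ⟨r - 1, by omega⟩)} }
  | .D21 m n _ _ _ =>
    { n := 2
      s := 2
      sq := ![-n / (2 * (m + n)), -m / (2 * (m + n))]
      pos := fun i => {(2 : ℝ) • e i}
      halfWeights := {e 0 + e 1, e 0 - e 1, -e 0 + e 1, -e 0 - e 1}
      hDual := 0
      p := fun k => (k + m / (m + n)) * (k + n / (m + n))
      rhoR := {(0, e 0), (1, e 1)} }
  | .F4 =>
    { n := 3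
      s := 1
      sq := fun _ => -2 / 3
      pos := fun _ => posB 3
      halfWeights := {η | ∀ a, η a = 1 / 2 ∨ η a = -1 / 2}
      hDual := -2
      p := fun k => (k + 2 / 3) * (k - 2 / 3)
      rhoR := {(0, e 0)} }

namespace RootData

variable (R : RootData)

/-- The invariant bilinear form `(·|·)` on weights. -/
def form (μ ν : Fin R.n → ℝ) : ℝ := ∑ a, R.sq a * μ a * ν a

/-- The value `ν(α^∨) = 2(ν|α)/(α|α)` of a weight on the coroot of the root `α`. -/
def onCoroot (ν α : Fin R.n → ℝ) : ℝ := 2 * R.form ν α / R.form α α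

/-- The roots of the simple ideal `𝔤♮_i`. -/
def roots (i : Fin R.s) : Set (Fin R.n → ℝ) := {α | α ∈ R.pos i ∨ -α ∈ R.pos i}

/-- `Δ♮`, the set of roots of `𝔤♮`. -/
def allRoots : Set (Fin R.n → ℝ) := ⋃ i, R.roots i

/-- `Δ♮_+`, the positive roots used in the Ramond sector. -/
def posR : Set (Fin R.n → ℝ) := ⋃ i, R.pos i

/-- `θ` is the highest root of `𝔤♮_i` for the positive system `P`: no positive root can be added. -/
def IsHighestRoot (P : Set (Fin R.n → ℝ)) (i : Fin R.s) (θ : Fin R.n → ℝ) : Prop :=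
  θ ∈ R.roots i ∧ θ ∈ P ∧ ∀ α ∈ P, θ + α ∉ R.roots i

/-- The highest root of `𝔤♮_i` for the positive system `P`. -/
def highestRoot (P : Set (Fin R.n → ℝ)) (i : Fin R.s) : Fin R.n → ℝ :=
  Classical.epsilon (R.IsHighestRoot P i)

/-- `θ♮_i`, the highest root of `𝔤♮_i` for `Δ♮_+`. -/
def theta (i : Fin R.s) : Fin R.n → ℝ := R.highestRoot R.posR i

/-- `M_i(k)`, the level of the affine vertex subalgebra of `𝔤♮_i`. In the four cases:
`-k - 1`; `-2k - 1`; `-(m+n)k/n - 1` and `-(m+n)k/m - 1`; `-3k/2 - 1`. -/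
def M (i : Fin R.s) (k : ℝ) : ℝ := 2 * k / R.form (R.theta i) (R.theta i) - 1

/-- `α(h^R)` for `h^R = 4 ρ_R / (θ♮_i|θ♮_i) ∈ 𝔥♮`, where `𝔥♮` and its dual are identified. -/
def onHR (i : Fin R.s) (ρR α : Fin R.n → ℝ) : ℝ :=
  4 * R.form α ρR / R.form (R.theta i) (R.theta i)

/-- `Δ^{NS}_+`, the positive system used in the Neveu-Schwarz sector. -/
def posNS (i : Fin R.s) (ρR : Fin R.n → ℝ) : Set (Fin R.n → ℝ) :=
  {α | α ∈ R.allRoots ∧ R.onHR i ρR α < 0} ∪ {α | α ∈ R.posR ∧ R.onHR i ρR α = 0}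

/-- The dominant integral weights `ν` for the positive system `P` such that `ν(θ_i^∨) ≤ M_i(k)` for all
`i`, where `θ_i` is the highest root of `𝔤♮_i` for `P`. -/
def levelWeights (P : Set (Fin R.n → ℝ)) (k : ℝ) : Set (Fin R.n → ℝ) :=
  {ν | (∀ α ∈ P, ∃ c : ℕ, R.onCoroot ν α = c) ∧
    ∀ i, R.onCoroot ν (R.highestRoot P i) ≤ R.M i k}

/-- `P^k_+(R)`. -/
def PR (k : ℝ) : Set (Fin R.n → ℝ) := R.levelWeights R.posR k

/-- `P^k_+(NS)`, which depends on the choice of `ρ_R`. -/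
def PNS (i : Fin R.s) (ρR : Fin R.n → ℝ) (k : ℝ) : Set (Fin R.n → ℝ) :=
  R.levelWeights (R.posNS i ρR) k

/-- `2ρ♮` for the positive system `P`: the sum of the roots in the finite set `P`. -/
def twoRho (P : Set (Fin R.n → ℝ)) : Fin R.n → ℝ := ∑ᶠ α ∈ P, α

/-- `ξ` is the highest weight of the `𝔤♮`-module `𝔤_{-1/2}` for the positive system `P`. -/
def IsHighestHalfWeight (P : Set (Fin R.n → ℝ)) (ξ : Fin R.n → ℝ) : Prop :=
  ξ ∈ R.halfWeights ∧ ∀ α ∈ P, ξ + α ∉ R.halfWeights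

/-- The highest weight of `𝔤_{-1/2}` for the positive system `P`. -/
def highestHalfWeight (P : Set (Fin R.n → ℝ)) : Fin R.n → ℝ :=
  Classical.epsilon (R.IsHighestHalfWeight P)

/-- The bound `A^{NS}(k,ν)`, for highest weights with respect to `Δ^{NS}_+`:
`(ν|ν+2ρ^{NS})/(2(k+h^∨)) + (ξ|ν)((ξ|ν) - k - 1)/(k+h^∨)`, where `2ρ^{NS}` is the sum of the roots in
`Δ^{NS}_+` and `ξ` is the highest weight of `𝔤_{-1/2}` for `Δ^{NS}_+`. In the four cases:
* `r/2` for `ν = -r ε`, `ε = (δ₁ - δ₂)/2`;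
* `-(∑_i (m_i² - 2(i-1)m_i) + m_r(2k - m_r + 2))/(4(k-r+2))` for `ν = ∑ m_i ε_i`, `ρ_R = ω_r`;
* `((m₁-m₂)² + 2t(m₂m + m₁n))/(4(m+n)t)` for `k = -mnt/(m+n)` and `ν = -m₁ε_2 + m₂ε_3`, `ρ_R = ω_1^1`
  (or `ν = m₁ε_2 - m₂ε_3`, `ρ_R = ω_1^2`);
* `(m₁(6-3k/2) + m₂(3-3k/2) - 3k m₃/2 + ∑ m_i² - ∑_{i<j} m_i m_j)/(3(3-3k/2))` for
  `ν = -m₁ε_1 + m₂ε_2 + m₃ε_3`. -/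
def ANS (i : Fin R.s) (ρR : Fin R.n → ℝ) (k : ℝ) (ν : Fin R.n → ℝ) : ℝ :=
  let P := R.posNS i ρR
  let ξ := R.highestHalfWeight P
  R.form ν (ν + R.twoRho P) / (2 * (k + R.hDual)) +
    R.form ξ ν / (k + R.hDual) * (R.form ξ ν - k - 1)

/-- The set of weights `η` of `𝔤_{-1/2}` with `η(h^R) > 0`; the odd zero modes `G^{v}_0` with `v` of
weight in this set annihilate Ramond highest weight vectors. Half of the sum of these weights, counted
with multiplicity, is `ρ_R`. -/
def posHalfWeights (i : Fin R.s) (ρR : Fin R.n → ℝ) : Set (Fin R.n → ℝ) :=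
  {η | η ∈ R.halfWeights ∧ 0 < R.onHR i ρR η}

/-- `η` is the minimal positive weight of `𝔤_{-1/2}`, with respect to `Δ♮_+`. -/
def IsMinHalfWeight (i : Fin R.s) (ρR η : Fin R.n → ℝ) : Prop :=
  η ∈ R.posHalfWeights i ρR ∧ ∀ α ∈ R.posR, η - α ∉ R.posHalfWeights i ρR

/-- The minimal positive weight of `𝔤_{-1/2}`. -/
def minHalfWeight (i : Fin R.s) (ρR : Fin R.n → ℝ) : Fin R.n → ℝ :=
  Classical.epsilon (R.IsMinHalfWeight i ρR)

/-- The bound `A^R(k,ν)`: the value of `ℓ` for which the norm of `G^{v}_0 v_{ν,ℓ}` is zero, where `v` has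
weight `-η` with `η` minimal. With `2ρ♮` the sum of the roots in `Δ♮_+`, it is
`((ν|ν+2ρ♮-2ρ_R) + 2(ν|η)(ν+2ρ♮-2ρ_R|η) - p(k)/2) / (2(k+h^∨))`. In the four cases:
* `-(k+1)/4`;
* `(-4 ∑_{i<r} (m_i² + (2(r-i)-1)m_i) - 4k² + 2(r-4)k + r - 3)/(16(k+2-r))` for `ν = ∑ m_i ε_i`;
* `((1+m₁+m₂)² + t(mnt-m-n))/(4(m+n)t)` for `k = -mnt/(m+n)` and `ν = m₁ε_2 + m₂ε_3`;
* `-(9k² + 8m₁² + 8m₁(m₂+m₃+5) + 8m₂² - 8m₂m₃ + 32m₂ + 8m₃² + 8m₃ - 4)/(36(k-2))` for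
  `ν = m₁ε_1 + m₂ε_2 + m₃ε_3`. -/
def AR (i : Fin R.s) (ρR : Fin R.n → ℝ) (k : ℝ) (ν : Fin R.n → ℝ) : ℝ :=
  let σ := R.twoRho R.posR - (2 : ℝ) • ρR
  let η := R.minHalfWeight i ρR
  (R.form ν (ν + σ) + 2 * R.form ν η * R.form (ν + σ) η - R.p k / 2) / (2 * (k + R.hDual))

end RootData

end MinimalW

end

/-!
Let `w` be the product of longest Weyl group elements, up to a diagram automorphism, that maps
`Δ^NS_+` onto `Δ♮_+`. It is an involutive isometry with `w ρ_R = -ρ_R`, it turns the highest weight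
`λ` of `𝔤_{-1/2}` into `ξ = w λ = -η`, and `2ρ^NS = w (2ρ♮) = 2ρ♮ - 2h ρ_R` with `h` the dual
Coxeter number of `𝔤♮_i`. Hence `ν ∈ P^k_+(NS)` means that `μ = w ν` lies in `P^k_+(R)`, and
`ν^R` is `w μ + M_i(k) ρ_R`. A positive root `α` not orthogonal to `ρ_R` is sent by `w` to a
negative one, so the level condition on `μ` bounds `μ((-w α)^∨)` by `M_i(k) ρ_R(α^∨)`: this is why
the shift restores dominance. With `Θ = (θ_i|θ_i)` one has `h^∨ = (h - 2) Θ / 2` and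
`p(k) = (k - Θ/2) (k + 2 + Θ/2 - 4 (ρ_R|ρ_R) / Θ)` in all four families, so that
`k + h^∨ = (M_i(k) + h - 1) Θ / 2` does not vanish and the equality of conformal weights becomes an
identity of rational functions.
-/

namespace MinimalW

open Function Set

section Climbing

variable {V : Type*} [Add V] {P Q : Set V} {x y : V}

/-- Every element of `Q` other than `x ∈ Q` can be raised inside `Q` by adding an element of `P`.
Highest roots and highest weights are recognised by this property. -/
def IsUniqueMaximal (P Q : Set V) (x : V) : Prop :=
  x ∈ Q ∧ ∀ y ∈ Q, y ≠ x → ∃ α ∈ P, y + α ∈ Q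

theorem IsUniqueMaximal.eq_of_forall_notMem (h : IsUniqueMaximal P Q x) (hy : y ∈ Q)
    (hmax : ∀ α ∈ P, y + α ∉ Q) : y = x := by
  by_contra hne
  obtain ⟨α, hα, hmem⟩ := h.2 y hy hne
  exact hmax α hα hmem

theorem IsUniqueMaximal.apply_le {δ φ : V → ℝ} (h : IsUniqueMaximal P Q x) (hQ : Q.Finite)
    (hδ : ∀ z, ∀ α ∈ P, δ z < δ (z + α)) (hφ : ∀ z, ∀ α ∈ P, φ z ≤ φ (z + α)) (hy : y ∈ Q) :
    φ y ≤ φ x := by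
  have hfin : {z ∈ Q | φ y ≤ φ z}.Finite := hQ.subset (sep_subset _ _)
  obtain ⟨z, ⟨hzQ, hyz⟩, hz⟩ := hfin.exists_maximalFor δ _ ⟨y, hy, le_rfl⟩
  obtain rfl : z = x := h.eq_of_forall_notMem hzQ fun α hα hmem =>
    (hδ z α hα).not_ge (hz ⟨hmem, hyz.trans (hφ z α hα)⟩ (hδ z α hα).le)
  exact hyz

theorem IsUniqueMaximal.add_notMem {δ : V → ℝ} (h : IsUniqueMaximal P Q x) (hQ : Q.Finite)
    (hδ : ∀ z, ∀ α ∈ P, δ z < δ (z + α)) {α : V} (hα : α ∈ P) : x + α ∉ Q := fun hmem =>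
  (hδ x α hα).not_ge (h.apply_le hQ hδ (fun z β hβ => (hδ z β hβ).le) hmem)

theorem epsilon_eq_of_forall_iff {α : Type*} [Nonempty α] {p : α → Prop} {a : α}
    (h : ∀ b, p b ↔ b = a) : Classical.epsilon p = a :=
  (h _).1 (Classical.epsilon_spec ⟨a, (h a).2 rfl⟩)

end Climbing

/-- A linear functional on weights, used to detect positivity of roots; its coefficients are
positive and strictly decreasing, hence it is positive on all `ε_a` and on all `ε_a ± ε_b`
with `a < b`. -/
def height {n : ℕ} (x : Fin n → ℝ) : ℝ := (fun a : Fin n => (n : ℝ) - a) ⬝ᵥ x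

theorem height_add {n : ℕ} (x y : Fin n → ℝ) : height (x + y) = height x + height y :=
  dotProduct_add _ _ _

theorem height_neg {n : ℕ} (x : Fin n → ℝ) : height (-x) = -height x := dotProduct_neg _ _

namespace RootData

variable {R : RootData}

section Form

variable (x y z : Fin R.n → ℝ) (c : ℝ)

theorem form_comm : R.form x y = R.form y x :=
  Finset.sum_congr rfl fun _ _ => mul_right_comm _ _ _

theorem form_add_right : R.form x (y + z) = R.form x y + R.form x z := by
  simp only [form, Pi.add_apply, mul_add, Finset.sum_add_distrib]

theorem form_smul_right : R.form x (c • y) = c * R.form x y := by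
  simp only [form, Pi.smul_apply, smul_eq_mul, Finset.mul_sum, mul_left_comm]

theorem form_neg_right : R.form x (-y) = -R.form x y := by
  rw [← neg_one_smul ℝ y, form_smul_right, neg_one_mul]

theorem form_sub_right : R.form x (y - z) = R.form x y - R.form x z := by
  rw [sub_eq_add_neg, form_add_right, form_neg_right, sub_eq_add_neg]

theorem form_add_left : R.form (x + y) z = R.form x z + R.form y z := by
  rw [form_comm, form_add_right, form_comm z, form_comm z]

theorem form_smul_left : R.form (c • x) y = c * R.form x y := by
  rw [form_comm, form_smul_right, form_comm]

theorem form_neg_left : R.form (-x) y = -R.form x y := by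
  rw [form_comm, form_neg_right, form_comm]

theorem form_sub_left : R.form (x - y) z = R.form x z - R.form y z := by
  rw [form_comm, form_sub_right, form_comm z, form_comm z]

variable {x}

theorem form_self_neg (hsq : ∀ a, R.sq a < 0) (hx : x ≠ 0) : R.form x x < 0 := by
  obtain ⟨a, ha⟩ := Function.ne_iff.1 hx
  simp only [form, mul_assoc]
  exact Finset.sum_neg' (fun b _ => mul_nonpos_of_nonpos_of_nonneg (hsq b).le (mul_self_nonneg _))
    ⟨a, Finset.mem_univ a, mul_neg_of_neg_of_pos (hsq a) (mul_self_pos.2 ha)⟩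

end Form

/-- The positive system `Δ♮_+` has highest roots `θ j`, and `𝔤_{-1/2}` has highest weight `lam`, all
characterised by raising operations; the form is negative definite. -/
structure IsHighestData (R : RootData) (θ : Fin R.s → Fin R.n → ℝ) (lam : Fin R.n → ℝ) : Prop where
  sq_neg : ∀ a, R.sq a < 0
  finite_pos : ∀ j, (R.pos j).Finite
  height_pos : ∀ j, ∀ α ∈ R.pos j, 0 < height α
  isUniqueMaximal_theta : ∀ j, IsUniqueMaximal R.posR (R.pos j) (θ j)
  finite_halfWeights : R.halfWeights.Finite
  neg_mem_halfWeights : ∀ μ ∈ R.halfWeights, -μ ∈ R.halfWeights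
  isUniqueMaximal_lam : IsUniqueMaximal R.posR R.halfWeights lam

namespace IsHighestData

variable {θ : Fin R.s → Fin R.n → ℝ} {lam : Fin R.n → ℝ} (H : R.IsHighestData θ lam)

include H

theorem height_pos_of_mem_posR {α : Fin R.n → ℝ} (hα : α ∈ R.posR) : 0 < height α := by
  obtain ⟨j, hj⟩ := mem_iUnion.1 hα
  exact H.height_pos j α hj

theorem height_lt (x : Fin R.n → ℝ) {α : Fin R.n → ℝ} (hα : α ∈ R.posR) :
    height x < height (x + α) := by
  rw [height_add]
  exact lt_add_of_pos_right _ (H.height_pos_of_mem_posR hα)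

theorem finite_posR : R.posR.Finite := finite_iUnion H.finite_pos

theorem theta_mem_posR (j : Fin R.s) : θ j ∈ R.posR :=
  mem_iUnion.2 ⟨j, (H.isUniqueMaximal_theta j).1⟩

theorem mem_pos_of_mem_roots {j : Fin R.s} {x : Fin R.n → ℝ} (hx : x ∈ R.roots j)
    (hpos : 0 < height x) : x ∈ R.pos j := by
  refine hx.resolve_right fun hneg => ?_
  have := H.height_pos j _ hneg
  rw [height_neg] at this
  linarith

theorem form_self_neg_of_mem_posR {α : Fin R.n → ℝ} (hα : α ∈ R.posR) : R.form α α < 0 := by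
  refine form_self_neg H.sq_neg fun h0 => (H.height_pos_of_mem_posR hα).ne' ?_
  rw [h0, height, dotProduct_zero]

theorem isHighestRoot_posR_iff {j : Fin R.s} {y : Fin R.n → ℝ} :
    R.IsHighestRoot R.posR j y ↔ y = θ j := by
  constructor
  · rintro ⟨hroot, hpos, hmax⟩
    exact (H.isUniqueMaximal_theta j).eq_of_forall_notMem
      (H.mem_pos_of_mem_roots hroot (H.height_pos_of_mem_posR hpos))
      fun α hα hmem => hmax α hα (Or.inl hmem)
  · rintro rfl
    refine ⟨Or.inl (H.isUniqueMaximal_theta j).1, H.theta_mem_posR j, fun α hα hroot => ?_⟩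
    refine (H.isUniqueMaximal_theta j).add_notMem (H.finite_pos j) (fun z β => H.height_lt z) hα
      (H.mem_pos_of_mem_roots hroot ?_)
    exact (H.height_pos_of_mem_posR (H.theta_mem_posR j)).trans (H.height_lt _ hα)

theorem theta_eq (j : Fin R.s) : R.theta j = θ j :=
  epsilon_eq_of_forall_iff fun _ => H.isHighestRoot_posR_iff

theorem isHighestHalfWeight_posR_iff {y : Fin R.n → ℝ} :
    R.IsHighestHalfWeight R.posR y ↔ y = lam := by
  constructor
  · rintro ⟨hy, hmax⟩
    exact H.isUniqueMaximal_lam.eq_of_forall_notMem hy hmax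
  · rintro rfl
    exact ⟨H.isUniqueMaximal_lam.1, fun α => H.isUniqueMaximal_lam.add_notMem
      H.finite_halfWeights fun z β => H.height_lt z⟩

theorem form_le_of_isUniqueMaximal {Q : Set (Fin R.n → ℝ)} {ν x y : Fin R.n → ℝ}
    (hx : IsUniqueMaximal R.posR Q x) (hQ : Q.Finite) (hν : ∀ α ∈ R.posR, R.form ν α ≤ 0)
    (hy : y ∈ Q) : R.form ν x ≤ R.form ν y := by
  refine neg_le_neg_iff.1 (hx.apply_le (φ := fun z => -R.form ν z) hQ (fun z α => H.height_lt z)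
    (fun z α hα => ?_) hy)
  rw [form_add_right]
  linarith [hν α hα]

theorem form_nonpos_of_mem_PR {μ α : Fin R.n → ℝ} {k : ℝ} (hμ : μ ∈ R.PR k) (hα : α ∈ R.posR) :
    R.form μ α ≤ 0 := by
  obtain ⟨c, hc⟩ := hμ.1 α hα
  have hneg := H.form_self_neg_of_mem_posR hα
  rw [onCoroot, div_eq_iff hneg.ne] at hc
  linarith [mul_nonpos_of_nonneg_of_nonpos c.cast_nonneg hneg.le]

theorem M_mul_form_theta_le {μ β : Fin R.n → ℝ} {j : Fin R.s} {k : ℝ} (hμ : μ ∈ R.PR k)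
    (hβ : β ∈ R.pos j) : R.M j k * R.form (θ j) (θ j) ≤ 2 * R.form μ β := by
  have hlevel : R.onCoroot μ (θ j) ≤ R.M j k := H.theta_eq j ▸ hμ.2 j
  rw [onCoroot, div_le_iff_of_neg (H.form_self_neg_of_mem_posR (H.theta_mem_posR j))] at hlevel
  linarith [H.form_le_of_isUniqueMaximal (H.isUniqueMaximal_theta j) (H.finite_pos j)
    (fun _ => H.form_nonpos_of_mem_PR hμ) hβ]

end IsHighestData

theorem neg_mem_roots {j : Fin R.s} {x : Fin R.n → ℝ} (hx : x ∈ R.roots j) : -x ∈ R.roots j :=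
  hx.symm.imp_right fun hpos => (neg_neg x).symm ▸ hpos

theorem onCoroot_eq_zero {x α : Fin R.n → ℝ} (hx : R.form α x = 0) : R.onCoroot x α = 0 := by
  rw [onCoroot, form_comm, hx, mul_zero, zero_div]

theorem onCoroot_neg_right (x α : Fin R.n → ℝ) : R.onCoroot x (-α) = -R.onCoroot x α := by
  rw [onCoroot, form_neg_left, form_neg_right, form_neg_right, neg_neg, mul_neg, neg_div, onCoroot]

section OnHR

variable (i : Fin R.s) (ρ x y : Fin R.n → ℝ)

theorem onHR_add : R.onHR i ρ (x + y) = R.onHR i ρ x + R.onHR i ρ y := by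
  rw [onHR, form_add_left, mul_add, add_div, onHR, onHR]

theorem onHR_neg : R.onHR i ρ (-x) = -R.onHR i ρ x := by
  rw [onHR, form_neg_left, mul_neg, neg_div, onHR]

theorem onHR_sub : R.onHR i ρ (x - y) = R.onHR i ρ x - R.onHR i ρ y := by
  rw [sub_eq_add_neg, onHR_add, onHR_neg, sub_eq_add_neg]

end OnHR

/-- `w` is an involutive isometry of weights that exchanges the Ramond and Neveu-Schwarz positive
systems attached to the minuscule coweight `h^R = 4ρ/Θ`, `Θ = (θ_i|θ_i)`. The number `h` is the dual
Coxeter number of `𝔤♮_i`. -/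
structure IsSpectralFlow (R : RootData) (θ : Fin R.s → Fin R.n → ℝ) (lam : Fin R.n → ℝ)
    (i : Fin R.s) (ρ : Fin R.n → ℝ) (w : (Fin R.n → ℝ) →ₗ[ℝ] Fin R.n → ℝ) (h : ℝ) : Prop
    extends R.IsHighestData θ lam where
  involutive : Involutive w
  form_map_map : ∀ x y, R.form (w x) (w y) = R.form x y
  map_mem_roots : ∀ j, ∀ α ∈ R.pos j, w α ∈ R.roots j
  map_mem_halfWeights : ∀ μ ∈ R.halfWeights, w μ ∈ R.halfWeights
  map_mem_posR : ∀ α ∈ R.posR, R.form α ρ = 0 → w α ∈ R.posR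
  onCoroot_nat : ∀ α ∈ R.posR, ∃ c : ℕ, R.onCoroot ρ α = c
  form_pos : ∀ α ∈ R.pos i, R.form α ρ = 0 ∨ 2 * R.form α ρ = R.form (θ i) (θ i)
  form_pos_ne : ∀ j ≠ i, ∀ α ∈ R.pos j, R.form α ρ = 0
  form_theta : 2 * R.form (θ i) ρ = R.form (θ i) (θ i)
  form_halfWeights : ∀ μ ∈ R.halfWeights,
    4 * R.form μ ρ = R.form (θ i) (θ i) ∨ 4 * R.form μ ρ = -R.form (θ i) (θ i)
  map_twoRho : w (R.twoRho R.posR) = R.twoRho R.posR - (2 * h) • ρ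
  form_twoRho_map : R.form (R.twoRho R.posR) (w lam) = -1 - R.form (θ i) (θ i)
  one_lt : 1 < h
  hDual_eq : R.hDual = (h - 2) * R.form (θ i) (θ i) / 2
  p_eq : ∀ k, R.p k = (k - R.form (θ i) (θ i) / 2) *
    (k + 2 + R.form (θ i) (θ i) / 2 - 4 * R.form ρ ρ / R.form (θ i) (θ i))

namespace IsSpectralFlow

variable {θ : Fin R.s → Fin R.n → ℝ} {lam : Fin R.n → ℝ} {i : Fin R.s} {ρ : Fin R.n → ℝ}
  {w : (Fin R.n → ℝ) →ₗ[ℝ] Fin R.n → ℝ} {h : ℝ} (S : R.IsSpectralFlow θ lam i ρ w h)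

include S

theorem form_map_left (x y : Fin R.n → ℝ) : R.form (w x) y = R.form x (w y) := by
  rw [← S.form_map_map x (w y), S.involutive y]

theorem map_rho : w ρ = -ρ := by
  have hτ := congrArg w S.map_twoRho
  rw [S.involutive, map_sub, S.map_twoRho, map_smul, sub_sub, eq_comm, sub_eq_self, ← smul_add,
    smul_eq_zero] at hτ
  have hh : 2 * h ≠ 0 := by linarith [S.one_lt]
  exact eq_neg_of_add_eq_zero_right (hτ.resolve_left hh)

theorem form_map_rho (x : Fin R.n → ℝ) : R.form (w x) ρ = -R.form x ρ := by
  rw [S.form_map_left, S.map_rho, form_neg_right]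

theorem form_twoRho_rho : R.form (R.twoRho R.posR) ρ = h * R.form ρ ρ := by
  have hτ := S.form_map_rho (R.twoRho R.posR)
  rw [S.map_twoRho, form_sub_left, form_smul_left] at hτ
  linarith

theorem form_theta_self_neg : R.form (θ i) (θ i) < 0 :=
  S.form_self_neg_of_mem_posR (S.theta_mem_posR i)

section OnHR

theorem onHR_eq (x : Fin R.n → ℝ) : R.onHR i ρ x = 4 * R.form x ρ / R.form (θ i) (θ i) := by
  rw [onHR, S.theta_eq]

theorem onHR_eq_zero_iff {x : Fin R.n → ℝ} : R.onHR i ρ x = 0 ↔ R.form x ρ = 0 := by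
  simp only [S.onHR_eq, div_eq_zero_iff, mul_eq_zero, OfNat.ofNat_ne_zero, false_or,
    S.form_theta_self_neg.ne, or_false]

theorem onHR_map (x : Fin R.n → ℝ) : R.onHR i ρ (w x) = -R.onHR i ρ x := by
  rw [onHR, S.form_map_rho, mul_neg, neg_div, onHR]

theorem onHR_of_mem_posR {α : Fin R.n → ℝ} (hα : α ∈ R.posR) :
    R.onHR i ρ α = 0 ∨ R.onHR i ρ α = 2 := by
  obtain ⟨j, hj⟩ := mem_iUnion.1 hα
  rw [S.onHR_eq_zero_iff]
  obtain rfl | hji := eq_or_ne j i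
  · refine (S.form_pos α hj).imp_right fun hΘ => ?_
    rw [S.onHR_eq, div_eq_iff S.form_theta_self_neg.ne]
    linarith
  · exact Or.inl (S.form_pos_ne j hji α hj)

theorem onHR_of_mem_halfWeights {μ : Fin R.n → ℝ} (hμ : μ ∈ R.halfWeights) :
    R.onHR i ρ μ = 1 ∨ R.onHR i ρ μ = -1 := by
  have hΘ := S.form_theta_self_neg.ne
  rw [S.onHR_eq, div_eq_iff hΘ, div_eq_iff hΘ, one_mul, neg_one_mul]
  exact S.form_halfWeights μ hμ

theorem form_lam_rho : 4 * R.form lam ρ = R.form (θ i) (θ i) := by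
  have hlam := S.isUniqueMaximal_lam.1
  have hρ : ∀ α ∈ R.posR, R.form ρ α ≤ 0 := fun α hα => by
    obtain ⟨c, hc⟩ := S.onCoroot_nat α hα
    have hneg := S.form_self_neg_of_mem_posR hα
    rw [onCoroot, div_eq_iff hneg.ne] at hc
    linarith [mul_nonpos_of_nonneg_of_nonpos c.cast_nonneg hneg.le]
  have hle := S.form_le_of_isUniqueMaximal S.isUniqueMaximal_lam S.finite_halfWeights hρ
    (S.neg_mem_halfWeights lam hlam)
  rw [form_neg_right, form_comm] at hle
  rcases S.form_halfWeights lam hlam with hΘ | hΘ <;> linarith [S.form_theta_self_neg]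

theorem form_map_lam_rho : R.form (w lam) ρ = -(R.form (θ i) (θ i) / 4) := by
  rw [S.form_map_rho, ← S.form_lam_rho]
  ring

theorem onHR_lam : R.onHR i ρ lam = 1 := by
  rw [S.onHR_eq, S.form_lam_rho, div_self S.form_theta_self_neg.ne]

end OnHR

section NeveuSchwarz

theorem map_mem_roots_iff {j : Fin R.s} {x : Fin R.n → ℝ} : w x ∈ R.roots j ↔ x ∈ R.roots j := by
  have hmap : ∀ y ∈ R.roots j, w y ∈ R.roots j := by
    rintro y (hy | hy)
    · exact S.map_mem_roots j y hy
    · have := neg_mem_roots (S.map_mem_roots j _ hy)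
      rwa [map_neg, neg_neg] at this
  exact ⟨fun hx => S.involutive x ▸ hmap _ hx, hmap x⟩

theorem map_mem_halfWeights_iff {x : Fin R.n → ℝ} : w x ∈ R.halfWeights ↔ x ∈ R.halfWeights :=
  ⟨fun hx => S.involutive x ▸ S.map_mem_halfWeights _ hx, S.map_mem_halfWeights x⟩

theorem mem_pos_of_onHR_pos {j : Fin R.s} {x : Fin R.n → ℝ} (hx : x ∈ R.roots j)
    (hpos : 0 < R.onHR i ρ x) : x ∈ R.pos j := by
  refine hx.resolve_right fun hneg => ?_
  have := S.onHR_of_mem_posR (mem_iUnion.2 ⟨j, hneg⟩)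
  rw [onHR_neg] at this
  rcases this with h0 | h2 <;> linarith

theorem mem_posNS_iff {x : Fin R.n → ℝ} : x ∈ R.posNS i ρ ↔ w x ∈ R.posR := by
  constructor
  · rintro (⟨hroot, hneg⟩ | ⟨hpos, hzero⟩)
    · obtain ⟨j, hj⟩ := mem_iUnion.1 hroot
      refine mem_iUnion.2 ⟨j, S.mem_pos_of_onHR_pos (S.map_mem_roots_iff.2 hj) ?_⟩
      rwa [S.onHR_map, neg_pos]
    · exact S.map_mem_posR x hpos (S.onHR_eq_zero_iff.1 hzero)
  · intro hwx
    obtain ⟨j, hj⟩ := mem_iUnion.1 hwx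
    have hx := S.onHR_map (w x)
    rw [S.involutive] at hx
    rcases S.onHR_of_mem_posR hwx with h0 | h2
    · refine Or.inr ⟨?_, by rw [hx, h0, neg_zero]⟩
      exact S.involutive x ▸ S.map_mem_posR _ hwx (S.onHR_eq_zero_iff.1 h0)
    · exact Or.inl ⟨mem_iUnion.2 ⟨j, S.map_mem_roots_iff.1 (Or.inl hj)⟩, by rw [hx, h2]; norm_num⟩

theorem highestRoot_posNS (j : Fin R.s) : R.highestRoot (R.posNS i ρ) j = w (θ j) := by
  refine epsilon_eq_of_forall_iff fun y => ?_
  rw [← S.involutive.eq_iff, ← S.isHighestRoot_posR_iff, IsHighestRoot,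
    IsHighestRoot, S.map_mem_roots_iff, S.mem_posNS_iff, S.involutive.surjective.forall]
  simp only [S.mem_posNS_iff, S.involutive _, ← S.map_mem_roots_iff (x := y + _), map_add]

theorem isHighestHalfWeight_posNS_iff {y : Fin R.n → ℝ} :
    R.IsHighestHalfWeight (R.posNS i ρ) y ↔ y = w lam := by
  rw [← S.involutive.eq_iff, ← S.isHighestHalfWeight_posR_iff,
    IsHighestHalfWeight, IsHighestHalfWeight, S.map_mem_halfWeights_iff,
    S.involutive.surjective.forall]
  simp only [S.mem_posNS_iff, S.involutive _, ← S.map_mem_halfWeights_iff (x := y + _), map_add]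

theorem highestHalfWeight_posNS : R.highestHalfWeight (R.posNS i ρ) = w lam :=
  epsilon_eq_of_forall_iff fun _ => S.isHighestHalfWeight_posNS_iff

theorem twoRho_posNS : R.twoRho (R.posNS i ρ) = R.twoRho R.posR - (2 * h) • ρ := by
  have himage : R.posNS i ρ = w '' R.posR := by
    ext x
    rw [S.mem_posNS_iff, S.involutive.image_eq_preimage_symm, mem_preimage]
  rw [← S.map_twoRho, himage, twoRho, finsum_mem_image S.involutive.injective.injOn, twoRho]
  exact (w.toAddMonoidHom.map_finsum_mem (fun x => x) S.finite_posR).symm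

end NeveuSchwarz

theorem minHalfWeight_eq : R.minHalfWeight i ρ = -w lam := by
  refine epsilon_eq_of_forall_iff fun y => ?_
  rw [← neg_eq_iff_eq_neg, ← S.isHighestHalfWeight_posNS_iff]
  have hneg {x : Fin R.n → ℝ} : -x ∈ R.halfWeights ↔ x ∈ R.halfWeights :=
    ⟨fun hx => neg_neg x ▸ S.neg_mem_halfWeights _ hx, S.neg_mem_halfWeights x⟩
  constructor
  · rintro ⟨⟨hy, hypos⟩, hmin⟩
    have hy1 : R.onHR i ρ y = 1 := (S.onHR_of_mem_halfWeights hy).resolve_right (by linarith)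
    refine ⟨hneg.2 hy, fun α hα hmem => ?_⟩
    rw [← hneg, neg_add, neg_neg, ← sub_eq_add_neg] at hmem
    have hval := S.onHR_of_mem_halfWeights hmem
    rw [onHR_sub, hy1] at hval
    rcases hα with ⟨-, hαneg⟩ | ⟨hαpos, hα0⟩
    · rcases hval with h1 | h1 <;> linarith
    · exact hmin α hαpos ⟨hmem, by rw [onHR_sub, hy1, hα0]; norm_num⟩
  · intro hmax
    have hy1 : R.onHR i ρ y = 1 := by
      rw [← neg_neg y, S.isHighestHalfWeight_posNS_iff.1 hmax, onHR_neg, S.onHR_map, neg_neg,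
        S.onHR_lam]
    refine ⟨⟨hneg.1 hmax.1, by rw [hy1]; exact one_pos⟩, fun α hα hmem => ?_⟩
    rcases S.onHR_of_mem_posR hα with h0 | h2
    · refine hmax.2 α (Or.inr ⟨hα, h0⟩) ?_
      rw [← hneg, neg_add, neg_neg, ← sub_eq_add_neg]
      exact hmem.1
    · have := hmem.2
      rw [onHR_sub, hy1, h2] at this
      linarith

section Weights

variable {k : ℝ}

theorem mem_PNS_iff {ν : Fin R.n → ℝ} : ν ∈ R.PNS i ρ k ↔ w ν ∈ R.PR k := by
  have hcoroot (α : Fin R.n → ℝ) : R.onCoroot ν (w α) = R.onCoroot (w ν) α := by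
    rw [onCoroot, onCoroot, S.form_map_map, S.form_map_left]
  refine and_congr ?_ (forall_congr' fun j => ?_)
  · rw [S.involutive.surjective.forall]
    simp only [S.mem_posNS_iff, S.involutive _, hcoroot]
  · rw [S.highestRoot_posNS, hcoroot, ← S.theta_eq, theta]

theorem onCoroot_map_add_smul (μ α : Fin R.n → ℝ) (c : ℝ) :
    R.onCoroot (w μ + c • ρ) α = R.onCoroot μ (w α) + c * R.onCoroot ρ α := by
  rw [onCoroot, onCoroot, onCoroot, form_add_left, form_smul_left, S.form_map_map,
    S.form_map_left]
  ring

theorem neg_map_mem_pos {α : Fin R.n → ℝ} (hα : α ∈ R.pos i)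
    (hρ : 2 * R.form α ρ = R.form (θ i) (θ i)) : -w α ∈ R.pos i := by
  refine S.mem_pos_of_onHR_pos (neg_mem_roots (S.map_mem_roots_iff.2 (Or.inl hα))) ?_
  rw [onHR_neg, S.onHR_map, neg_neg, S.onHR_eq]
  exact div_pos_of_neg_of_neg (by linarith [S.form_theta_self_neg]) S.form_theta_self_neg

theorem onCoroot_neg_map_le {μ α : Fin R.n → ℝ} (hμ : μ ∈ R.PR k) (hα : α ∈ R.pos i)
    (hρ : 2 * R.form α ρ = R.form (θ i) (θ i)) :
    R.onCoroot μ (-w α) ≤ R.M i k * R.onCoroot ρ α := by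
  have hle := S.M_mul_form_theta_le hμ (S.neg_map_mem_pos hα hρ)
  rw [onCoroot, form_neg_left (w α), form_neg_right (w α), neg_neg, S.form_map_map, onCoroot,
    form_comm ρ, hρ, ← mul_div_assoc]
  exact div_le_div_of_nonpos_of_le (S.form_self_neg_of_mem_posR (mem_iUnion.2 ⟨i, hα⟩)).le hle

theorem exists_onCoroot_map_add_smul_eq {μ α : Fin R.n → ℝ} {N : ℕ} (hN : R.M i k = N)
    (hμ : μ ∈ R.PR k) (hα : α ∈ R.posR) :
    ∃ c : ℕ, R.onCoroot (w μ + R.M i k • ρ) α = c := by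
  rw [S.onCoroot_map_add_smul]
  have hcase : R.form α ρ = 0 ∨ α ∈ R.pos i ∧ 2 * R.form α ρ = R.form (θ i) (θ i) := by
    obtain ⟨j, hj⟩ := mem_iUnion.1 hα
    obtain rfl | hji := eq_or_ne j i
    · exact (S.form_pos α hj).imp_right fun hΘ => ⟨hj, hΘ⟩
    · exact Or.inl (S.form_pos_ne j hji α hj)
  rcases hcase with h0 | ⟨hi, hΘ⟩
  · obtain ⟨c, hc⟩ := hμ.1 _ (S.map_mem_posR α hα h0)
    exact ⟨c, by rw [onCoroot_eq_zero (x := ρ) h0, mul_zero, add_zero, hc]⟩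
  · obtain ⟨c, hc⟩ := hμ.1 _ (mem_iUnion.2 ⟨i, S.neg_map_mem_pos hi hΘ⟩)
    obtain ⟨d, hd⟩ := S.onCoroot_nat α hα
    have hcd : c ≤ N * d := by
      have hle := S.onCoroot_neg_map_le hμ hi hΘ
      rw [hc, hN, hd] at hle
      exact_mod_cast hle
    rw [onCoroot_neg_right, neg_eq_iff_eq_neg] at hc
    refine ⟨N * d - c, ?_⟩
    rw [hc, hN, hd, Nat.cast_sub hcd, Nat.cast_mul, neg_add_eq_sub]

theorem onCoroot_map_add_smul_theta_le {μ : Fin R.n → ℝ} (hμ : μ ∈ R.PR k) (j : Fin R.s) :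
    R.onCoroot (w μ + R.M i k • ρ) (θ j) ≤ R.M j k := by
  rw [S.onCoroot_map_add_smul]
  have hpos := (S.isUniqueMaximal_theta j).1
  obtain rfl | hji := eq_or_ne j i
  · obtain ⟨c, hc⟩ := hμ.1 _ (mem_iUnion.2 ⟨j, S.neg_map_mem_pos hpos S.form_theta⟩)
    rw [onCoroot_neg_right, neg_eq_iff_eq_neg] at hc
    rw [hc, onCoroot, form_comm ρ, S.form_theta, div_self S.form_theta_self_neg.ne, mul_one]
    exact add_le_of_nonpos_left (neg_nonpos.2 c.cast_nonneg)
  · have h0 := S.form_pos_ne j hji _ hpos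
    have hneg := S.form_self_neg_of_mem_posR (S.theta_mem_posR j)
    have hwpos : w (θ j) ∈ R.pos j := S.mem_pos_of_mem_roots (S.map_mem_roots_iff.2 (Or.inl hpos))
      (S.height_pos_of_mem_posR (S.map_mem_posR _ (S.theta_mem_posR j) h0))
    rw [onCoroot_eq_zero (x := ρ) h0, mul_zero, add_zero, onCoroot, S.form_map_map,
      div_le_iff_of_neg hneg]
    exact S.M_mul_form_theta_le hμ hwpos

theorem map_add_smul_mem_PR {μ : Fin R.n → ℝ} {N : ℕ} (hN : R.M i k = N) (hμ : μ ∈ R.PR k) :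
    w μ + R.M i k • ρ ∈ R.PR k := by
  refine ⟨fun α => S.exists_onCoroot_map_add_smul_eq hN hμ, fun j => ?_⟩
  have hle := S.onCoroot_map_add_smul_theta_le hμ j
  rwa [← S.theta_eq] at hle

theorem mem_PNS_iff_add_smul_mem_PR {ν : Fin R.n → ℝ} {N : ℕ} (hN : R.M i k = N) :
    ν ∈ R.PNS i ρ k ↔ ν + R.M i k • ρ ∈ R.PR k := by
  rw [S.mem_PNS_iff]
  constructor <;> intro hmem
  · have := S.map_add_smul_mem_PR hN hmem
    rwa [S.involutive] at this
  · have := S.map_add_smul_mem_PR hN hmem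
    rwa [map_add, map_smul, S.map_rho, smul_neg, neg_add_cancel_right] at this

end Weights

section ConformalWeight

variable {k : ℝ}

theorem ANS_eq (ν : Fin R.n → ℝ) : R.ANS i ρ k ν =
    (R.form ν ν + R.form ν (R.twoRho R.posR) - 2 * h * R.form ν ρ) / (2 * (k + R.hDual)) +
      R.form (w lam) ν / (k + R.hDual) * (R.form (w lam) ν - k - 1) := by
  simp only [ANS, S.highestHalfWeight_posNS, S.twoRho_posNS, form_add_right, form_sub_right,
    form_smul_right, add_sub_assoc]

theorem AR_eq (ν : Fin R.n → ℝ) : R.AR i ρ k ν =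
    (R.form ν ν + R.form ν (R.twoRho R.posR) - 2 * R.form ν ρ +
      2 * R.form (w lam) ν * (R.form (w lam) ν - 1 - R.form (θ i) (θ i) / 2) - R.p k / 2) /
      (2 * (k + R.hDual)) := by
  simp only [AR, S.minHalfWeight_eq, form_add_right, form_sub_right, form_smul_right,
    form_neg_right, form_add_left, form_sub_left, form_smul_left, S.form_twoRho_map,
    form_comm ν (w lam), form_comm ρ (w lam), S.form_map_lam_rho]
  ring

theorem ANS_add_eq_AR (hM : 0 ≤ R.M i k) (ν : Fin R.n → ℝ) :
    R.ANS i ρ k ν + 2 / R.form (R.theta i) (R.theta i) * R.form ν ρ +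
        1 / R.form (R.theta i) (R.theta i) * R.M i k * R.form ρ ρ =
      R.AR i ρ k (ν + R.M i k • ρ) := by
  have hΘ := S.form_theta_self_neg.ne
  have hk : k = R.form (θ i) (θ i) * (R.M i k + 1) / 2 := by
    rw [M, S.theta_eq]
    field_simp
    ring
  have hkh : k + R.hDual = R.form (θ i) (θ i) / 2 * (R.M i k + h - 1) := by
    rw [S.hDual_eq]
    linear_combination hk
  have hMh : R.M i k + h - 1 ≠ 0 := by linarith [S.one_lt]
  rw [S.ANS_eq, S.AR_eq, S.p_eq, hkh, S.theta_eq]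
  simp only [form_add_right, form_add_left, form_smul_right, form_smul_left, S.form_map_lam_rho,
    form_comm ρ ν, form_comm ρ (R.twoRho R.posR), S.form_twoRho_rho]
  generalize R.M i k = M at *
  subst hk
  field_simp
  ring

end ConformalWeight

end IsSpectralFlow

end RootData

open RootData

section Coordinates

variable {n : ℕ}

theorem e_apply (a b : Fin n) : e a b = if b = a then 1 else 0 := Pi.single_apply a 1 b

theorem e_apply_self (a : Fin n) : e a a = 1 := Pi.single_eq_same a 1

theorem e_apply_of_ne {a b : Fin n} (h : b ≠ a) : e a b = 0 := Pi.single_eq_of_ne h 1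

theorem e_injective : Injective (e : Fin n → Fin n → ℝ) := fun a b hab => by
  by_contra hne
  have ha := congrFun hab a
  rw [e_apply_self, e_apply_of_ne hne] at ha
  exact one_ne_zero ha

theorem dotProduct_e (x : Fin n → ℝ) (a : Fin n) : x ⬝ᵥ e a = x a := dotProduct_single_one x a

theorem height_e (a : Fin n) : height (e a) = n - a := dotProduct_e _ a

theorem height_e_pos (a : Fin n) : 0 < height (e a) := by
  rw [height_e, sub_pos, Nat.cast_lt]
  exact a.isLt

theorem form_e_right {R : RootData} (x : Fin R.n → ℝ) (a : Fin R.n) :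
    R.form x (e a) = R.sq a * x a := dotProduct_e (fun b => R.sq b * x b) a

/-- The reflection `x ↦ x - 2 x_a ε_a`, the map `w` of `IsSpectralFlow` when `ρ_R = ε_a`. -/
def coordReflection (a : Fin n) : (Fin n → ℝ) →ₗ[ℝ] Fin n → ℝ :=
  LinearMap.id - ((2 : ℝ) • LinearMap.proj a).smulRight (e a)

theorem coordReflection_apply (a : Fin n) (x : Fin n → ℝ) :
    coordReflection a x = x - (2 * x a) • e a := rfl

theorem coordReflection_apply_self (a : Fin n) (x : Fin n → ℝ) : coordReflection a x a = -x a := by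
  rw [coordReflection_apply, Pi.sub_apply, Pi.smul_apply, e_apply_self, smul_eq_mul]
  ring

theorem coordReflection_apply_of_ne {a b : Fin n} (hb : b ≠ a) (x : Fin n → ℝ) :
    coordReflection a x b = x b := by
  rw [coordReflection_apply, Pi.sub_apply, Pi.smul_apply, e_apply_of_ne hb, smul_zero, sub_zero]

theorem coordReflection_of_eq_zero {a : Fin n} {x : Fin n → ℝ} (hx : x a = 0) :
    coordReflection a x = x := by
  rw [coordReflection_apply, hx, mul_zero, zero_smul, sub_zero]

theorem coordReflection_e (a : Fin n) : coordReflection a (e a) = -e a := by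
  rw [coordReflection_apply, e_apply_self]
  module

theorem coordReflection_involutive (a : Fin n) : Involutive (coordReflection a) := fun x => by
  rw [coordReflection_apply a x, map_sub, map_smul, coordReflection_e, coordReflection_apply]
  module

theorem form_coordReflection {R : RootData} (a : Fin R.n) (x y : Fin R.n → ℝ) :
    R.form (coordReflection a x) (coordReflection a y) = R.form x y := by
  simp only [coordReflection_apply, form_sub_left, form_sub_right, form_smul_left,
    form_smul_right, form_comm (e a), form_e_right, Pi.sub_apply, Pi.smul_apply, smul_eq_mul,
    e_apply_self]
  ring

/-- The vectors with all coordinates `±c`: the weights of `𝔤_{-1/2}` for `psl(2|2)`, `D(2,1;m/n)`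
(`c = 1`) and `F(4)` (`c = ½`). -/
def cube (n : ℕ) (c : ℝ) : Set (Fin n → ℝ) := {x | ∀ a, x a = c ∨ x a = -c}

variable {c : ℝ}

theorem finite_cube : (cube n c).Finite := Finite.pi' fun _ => toFinite {c, -c}

theorem neg_mem_cube {x : Fin n → ℝ} (hx : x ∈ cube n c) : -x ∈ cube n c := fun a =>
  (hx a).symm.imp (fun h => neg_eq_iff_eq_neg.2 h) (fun h => congrArg Neg.neg h)

theorem coordReflection_mem_cube {x : Fin n → ℝ} (a : Fin n) (hx : x ∈ cube n c) :
    coordReflection a x ∈ cube n c := fun b => by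
  obtain rfl | hb := eq_or_ne b a
  · rw [coordReflection_apply_self]
    exact neg_mem_cube hx b
  · rw [coordReflection_apply_of_ne hb]
    exact hx b

theorem isUniqueMaximal_cube {P : Set (Fin n → ℝ)} (hP : ∀ a, (2 * c) • e a ∈ P) :
    IsUniqueMaximal P (cube n c) fun _ => c := by
  refine ⟨fun _ => Or.inl rfl, fun y hy hne => ?_⟩
  obtain ⟨a, ha⟩ := Function.ne_iff.1 hne
  refine ⟨_, hP a, fun b => ?_⟩
  rw [Pi.add_apply, Pi.smul_apply, smul_eq_mul]
  obtain rfl | hb := eq_or_ne b a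
  · rw [e_apply_self, (hy b).resolve_left ha]
    exact Or.inl (by ring)
  · rw [e_apply_of_ne hb, mul_zero, add_zero]
    exact hy b

end Coordinates

section SL2Power

/-- The data with `𝔤♮ = sl(2)^n`, positive roots `2ε_j` and `𝔤_{-1/2}` the exterior tensor product
of the standard representations; it covers `psl(2|2)` and `D(2,1;m/n)`. -/
abbrev sl2Power (n : ℕ) (sq : Fin n → ℝ) (p : ℝ → ℝ) (rhoR : Set (Fin n × (Fin n → ℝ))) :
    RootData where
  n := n
  s := n
  sq := sq
  pos j := {(2 : ℝ) • e j}
  halfWeights := cube n 1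
  hDual := 0
  p := p
  rhoR := rhoR

variable {n : ℕ} {sq : Fin n → ℝ} {p : ℝ → ℝ} {rhoR : Set (Fin n × (Fin n → ℝ))}

theorem sl2Power_posR : (sl2Power n sq p rhoR).posR = range fun j : Fin n => (2 : ℝ) • e j :=
  iUnion_singleton_eq_range _

theorem sl2Power_twoRho :
    (sl2Power n sq p rhoR).twoRho (sl2Power n sq p rhoR).posR = fun _ => 2 := by
  have hinj : Injective fun j : Fin n => (2 : ℝ) • (e j : Fin n → ℝ) :=
    (smul_right_injective _ two_ne_zero).comp e_injective
  rw [sl2Power_posR, twoRho, finsum_mem_range hinj, finsum_eq_sum_of_fintype]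
  ext a
  simp [e_apply]

theorem sl2Power_isHighestData (hsq : ∀ a, sq a < 0) :
    (sl2Power n sq p rhoR).IsHighestData (fun j => (2 : ℝ) • e j) fun _ => 1 where
  sq_neg := hsq
  finite_pos _ := finite_singleton _
  height_pos := by
    rintro j _ rfl
    rw [two_smul, height_add]
    exact add_pos (height_e_pos j) (height_e_pos j)
  isUniqueMaximal_theta _ := ⟨rfl, fun _ hy hne => absurd hy hne⟩
  finite_halfWeights := finite_cube
  neg_mem_halfWeights _ := neg_mem_cube
  isUniqueMaximal_lam := isUniqueMaximal_cube fun a => by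
    rw [mul_one, sl2Power_posR]
    exact mem_range_self a

theorem sl2Power_form_e (x : Fin n → ℝ) (j : Fin n) :
    (sl2Power n sq p rhoR).form x (e j) = sq j * x j :=
  form_e_right (R := sl2Power n sq p rhoR) x j

theorem sl2Power_form_root (j : Fin n) :
    (sl2Power n sq p rhoR).form ((2 : ℝ) • e j) ((2 : ℝ) • e j) = 4 * sq j := by
  rw [form_smul_left, form_smul_right, sl2Power_form_e, e_apply_self]
  ring

theorem sl2Power_onCoroot_e (hsq : ∀ a, sq a < 0) (i j : Fin n) :
    (sl2Power n sq p rhoR).onCoroot (e i) ((2 : ℝ) • e j) = if j = i then 1 else 0 := by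
  rw [onCoroot, sl2Power_form_root, form_smul_right, sl2Power_form_e, e_apply,
    div_eq_iff (mul_neg_of_pos_of_neg four_pos (hsq j)).ne]
  split_ifs <;> ring

theorem two_smul_e_apply_of_ne {i j : Fin n} (h : j ≠ i) :
    ((2 : ℝ) • e j : Fin n → ℝ) i = 0 := by
  rw [Pi.smul_apply, e_apply_of_ne h.symm, smul_zero]

theorem sl2Power_form_two_reflection_one (hsum : ∑ a, sq a = -1 / 2) (i : Fin n) :
    (sl2Power n sq p rhoR).form (fun _ => 2) (coordReflection i fun _ => 1) = -1 - 4 * sq i := by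
  have htwo : (sl2Power n sq p rhoR).form (fun _ => 2) (fun _ => 1) = 2 * ∑ a, sq a := by
    simp only [form, mul_one, Finset.mul_sum, mul_comm (sq _)]
  rw [coordReflection_apply, form_sub_right, form_smul_right, sl2Power_form_e, htwo, hsum]
  ring

theorem sl2Power_isSpectralFlow (hsq : ∀ a, sq a < 0) (hsum : ∑ a, sq a = -1 / 2) (i : Fin n)
    (hp : ∀ k, p k = (k - 2 * sq i) * (k + 1 + 2 * sq i)) :
    (sl2Power n sq p rhoR).IsSpectralFlow (fun j => (2 : ℝ) • e j) (fun _ => 1) i (e i)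
      (coordReflection i) 2 where
  toIsHighestData := sl2Power_isHighestData hsq
  involutive := coordReflection_involutive i
  form_map_map := form_coordReflection (R := sl2Power n sq p rhoR) i
  map_mem_roots := by
    rintro j _ rfl
    obtain rfl | hj := eq_or_ne j i
    · exact Or.inr (by rw [map_smul, coordReflection_e, smul_neg, neg_neg]; rfl)
    · exact Or.inl (coordReflection_of_eq_zero (two_smul_e_apply_of_ne hj))
  map_mem_halfWeights _ := coordReflection_mem_cube i
  map_mem_posR α hα h0 := by
    rw [sl2Power_form_e, mul_eq_zero, or_iff_right (hsq i).ne] at h0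
    rwa [coordReflection_of_eq_zero h0]
  onCoroot_nat := by
    rw [sl2Power_posR]
    rintro _ ⟨j, rfl⟩
    exact ⟨if j = i then 1 else 0, by rw [sl2Power_onCoroot_e hsq]; push_cast; rfl⟩
  form_theta := by
    rw [sl2Power_form_root, sl2Power_form_e, Pi.smul_apply, e_apply_self, smul_eq_mul]
    ring
  form_pos := by
    rintro _ rfl
    right
    rw [sl2Power_form_root, sl2Power_form_e, Pi.smul_apply, e_apply_self, smul_eq_mul]
    ring
  form_pos_ne := by
    rintro j hj _ rfl
    rw [sl2Power_form_e, two_smul_e_apply_of_ne hj, mul_zero]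
  form_halfWeights μ hμ := by
    rw [sl2Power_form_root, sl2Power_form_e]
    refine (hμ i).imp (fun h => ?_) (fun h => ?_) <;>
    · rw [h]
      ring
  map_twoRho := by
    rw [sl2Power_twoRho]
    rfl
  form_twoRho_map := by
    rw [sl2Power_twoRho, sl2Power_form_two_reflection_one hsum, sl2Power_form_root]
  one_lt := one_lt_two
  hDual_eq := by
    rw [sub_self, zero_mul, zero_div]
  p_eq k := by
    refine (hp k).trans ?_
    rw [sl2Power_form_root, sl2Power_form_e, e_apply_self, mul_one,
      div_self (mul_neg_of_pos_of_neg four_pos (hsq i)).ne]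
    ring

end SL2Power

section D21

/-- The data of `D(2,1;m/n)`, for an arbitrary list of Ramond weights. -/
noncomputable abbrev d21Data (m n : ℕ) (rhoR : Set (Fin 2 × (Fin 2 → ℝ))) : RootData :=
  sl2Power 2 ![-n / (2 * (m + n)), -m / (2 * (m + n))]
    (fun k => (k + m / (m + n)) * (k + n / (m + n))) rhoR

theorem d21Data_isSpectralFlow {m n : ℕ} (hm : 0 < m) (hn : 0 < n) (i : Fin 2)
    {rhoR : Set (Fin 2 × (Fin 2 → ℝ))} :
    (d21Data m n rhoR).IsSpectralFlow (fun j => (2 : ℝ) • e j) (fun _ => 1) i (e i)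
      (coordReflection i) 2 := by
  have hm' : (0 : ℝ) < m := Nat.cast_pos.2 hm
  have hn' : (0 : ℝ) < n := Nat.cast_pos.2 hn
  refine sl2Power_isSpectralFlow (Fin.forall_fin_two.2 ⟨?_, ?_⟩) ?_ i fun k => ?_
  · exact div_neg_of_neg_of_pos (neg_neg_of_pos hn') (by positivity)
  · exact div_neg_of_neg_of_pos (neg_neg_of_pos hm') (by positivity)
  · rw [Fin.sum_univ_two, Matrix.cons_val_zero, Matrix.cons_val_one, Matrix.cons_val_zero]
    field_simp
    ring
  · revert i
    refine Fin.forall_fin_two.2 ⟨?_, ?_⟩ <;>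
    · simp only [Matrix.cons_val_zero, Matrix.cons_val_one]
      field_simp
      ring

end D21

section Orthogonal

variable {r : ℕ}

theorem mem_posD_iff {α : Fin r → ℝ} :
    α ∈ posD r ↔ ∃ a b : Fin r, a < b ∧ ∃ u : ℝ, (u = 1 ∨ u = -1) ∧ α = e a + u • e b := by
  simp only [posD, mem_ofPred_eq, or_and_right, exists_or, exists_eq_left, one_smul, neg_smul,
    ← sub_eq_add_neg]

theorem add_mem_posD {a b : Fin r} (hab : a ≠ b) : e a + e b ∈ posD r := by
  rcases hab.lt_or_gt with hlt | hgt
  · exact ⟨a, b, hlt, Or.inl rfl⟩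
  · exact ⟨b, a, hgt, Or.inl (add_comm _ _)⟩

theorem sub_mem_posD {a b : Fin r} (hab : a < b) : e a - e b ∈ posD r := ⟨a, b, hab, Or.inr rfl⟩

theorem smul_add_smul_mem_posD_or {a b : Fin r} (hab : a ≠ b) {u v : ℝ} (hu : u = 1 ∨ u = -1)
    (hv : v = 1 ∨ v = -1) :
    u • e a + v • e b ∈ posD r ∨ -(u • e a + v • e b) ∈ posD r := by
  wlog hlt : a < b generalizing a b u v
  · rw [add_comm]
    exact this hab.symm hv hu (hab.lt_or_gt.resolve_left hlt)
  rcases hu with rfl | rfl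
  · exact Or.inl (mem_posD_iff.2 ⟨a, b, hlt, v, hv, by rw [one_smul]⟩)
  · refine Or.inr (mem_posD_iff.2 ⟨a, b, hlt, -v, hv.symm.imp (fun h => ?_) (fun h => ?_), ?_⟩)
    · rw [h, neg_neg]
    · rw [h]
    · module

theorem height_pos_of_mem_posD {α : Fin r → ℝ} (hα : α ∈ posD r) : 0 < height α := by
  obtain ⟨a, b, hab, rfl | rfl⟩ := hα
  · rw [height_add]
    exact add_pos (height_e_pos a) (height_e_pos b)
  · rw [sub_eq_add_neg, height_add, height_neg, height_e, height_e, ← sub_eq_add_neg,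
      sub_sub_sub_cancel_left, sub_pos, Nat.cast_lt]
    exact hab

theorem dotProduct_self_add_smul {a b : Fin r} (hab : a < b) {u : ℝ} (hu : u = 1 ∨ u = -1) :
    (e a + u • e b) ⬝ᵥ (e a + u • e b) = 2 := by
  have huu : u * u = 1 := by rcases hu with rfl | rfl <;> norm_num
  simp only [dotProduct_add, dotProduct_smul, dotProduct_e, Pi.add_apply, Pi.smul_apply,
    e_apply_self, e_apply_of_ne hab.ne, e_apply_of_ne hab.ne', smul_eq_mul]
  linear_combination huu

theorem isUniqueMaximal_posD (m : ℕ) :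
    IsUniqueMaximal (posD (m + 3)) (posD (m + 3)) (e 0 + e 1) := by
  refine ⟨add_mem_posD Fin.zero_ne_one, fun y hy hne => ?_⟩
  obtain ⟨a, b, hab, u, hu, rfl⟩ := mem_posD_iff.1 hy
  obtain rfl | ha := eq_or_ne a 0
  · rcases hu with rfl | rfl
    · have hb : 1 < b := (Fin.one_le_of_ne_zero hab.ne').lt_of_ne fun h => hne (by rw [h, one_smul])
      refine ⟨_, sub_mem_posD hb, ?_⟩
      rw [one_smul, add_add_sub_cancel]
      exact add_mem_posD Fin.zero_ne_one
    · obtain ⟨c, hc⟩ := Finset.exists_mem_notMem_of_card_lt_card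
        (s := {0, b}) (t := Finset.univ) (Finset.card_le_two.trans_lt (by simp))
      simp only [Finset.mem_univ, Finset.mem_insert, Finset.mem_singleton, not_or, true_and] at hc
      refine ⟨_, add_mem_posD (Ne.symm hc.2), ?_⟩
      rw [neg_one_smul, ← sub_eq_add_neg, ← add_assoc, sub_add_cancel]
      exact add_mem_posD (Ne.symm hc.1)
  · refine ⟨_, sub_mem_posD (Fin.pos_iff_ne_zero.2 ha), mem_posD_iff.2
      ⟨0, b, (Fin.zero_le a).trans_lt hab, u, hu, ?_⟩⟩
    module

/-- Index set of `posD r`: the triple `⟨a, b, u⟩` stands for the root `ε_a + u ε_b`. -/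
noncomputable def posDIndex (r : ℕ) : Finset ((_ : Fin r) × Fin r × ℝ) :=
  Finset.univ.sigma fun a => Finset.Ioi a ×ˢ {1, -1}

theorem posD_eq_image : posD r =
    (fun p : (_ : Fin r) × Fin r × ℝ => e p.1 + p.2.2 • e p.2.1) '' (posDIndex r) := by
  ext α
  simp only [mem_posD_iff, posDIndex, mem_image, Finset.mem_coe, Finset.mem_sigma, Finset.mem_univ,
    true_and, Finset.mem_product, Finset.mem_Ioi, Finset.mem_insert, Finset.mem_singleton,
    Sigma.exists, Prod.exists, and_assoc, exists_and_left, eq_comm (a := α)]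

theorem finite_posD : (posD r).Finite := by
  rw [posD_eq_image]
  exact (posDIndex r).finite_toSet.image _

theorem le_of_add_smul_eq {a b a' b' : Fin r} {u u' : ℝ} (hab : a < b)
    (hab' : a' < b') (heq : e a + u • e b = e a' + u' • e b') : a' ≤ a := by
  by_contra! hlt
  have ha := congrFun heq a
  rw [Pi.add_apply, Pi.add_apply, Pi.smul_apply, Pi.smul_apply, e_apply_self,
    e_apply_of_ne hab.ne, e_apply_of_ne hlt.ne, e_apply_of_ne (hlt.trans hab').ne, smul_zero,
    smul_zero, add_zero, add_zero] at ha
  exact one_ne_zero ha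

theorem injOn_posDIndex :
    InjOn (fun p : (_ : Fin r) × Fin r × ℝ => (e p.1 + p.2.2 • e p.2.1 : Fin r → ℝ))
      (posDIndex r) := by
  rintro ⟨a, b, u⟩ hp ⟨a', b', u'⟩ hp' heq
  simp only [posDIndex, Finset.mem_coe, Finset.mem_sigma, Finset.mem_univ, true_and,
    Finset.mem_product, Finset.mem_Ioi, Finset.mem_insert, Finset.mem_singleton] at hp hp' heq
  obtain ⟨⟨hab, hu⟩, hab', -⟩ := hp, hp'
  obtain rfl := le_antisymm (le_of_add_smul_eq hab' hab heq.symm) (le_of_add_smul_eq hab hab' heq)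
  have hbb' : u = u' * e b' b := by
    have hb := congrFun (add_left_cancel heq) b
    rwa [Pi.smul_apply, Pi.smul_apply, e_apply_self, smul_eq_mul, mul_one] at hb
  obtain rfl : b = b' := by
    by_contra hne
    rw [e_apply_of_ne hne, mul_zero] at hbb'
    rcases hu with rfl | rfl <;> norm_num at hbb'
  rw [hbb', e_apply_self, mul_one]

theorem finsum_mem_posD : ∑ᶠ α ∈ posD r, α = fun a : Fin r => 2 * ((r : ℝ) - 1 - a) := by
  rw [posD_eq_image, finsum_mem_image injOn_posDIndex, finsum_mem_coe_finset, posDIndex,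
    Finset.sum_sigma]
  have hpair (a b : Fin r) :
      ∑ u ∈ ({1, -1} : Finset ℝ), (e a + u • e b) = (2 : ℝ) • (e a : Fin r → ℝ) := by
    rw [Finset.sum_pair (by norm_num)]
    module
  simp only [Finset.sum_product, hpair, Finset.sum_const, Fin.card_Ioi, Nat.sub_sub,
    ← Nat.cast_smul_eq_nsmul ℝ, smul_smul]
  ext c
  have hc : (c : ℕ) + 1 ≤ r := c.isLt
  simp only [Finset.sum_apply, Pi.smul_apply, e_apply, smul_eq_mul, mul_ite, mul_one, mul_zero,
    Finset.sum_ite_eq, Finset.mem_univ, if_true]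
  rw [add_comm, Nat.cast_sub hc]
  push_cast
  ring

theorem e_mem_posB (a : Fin r) : e a ∈ posB r := Or.inr ⟨a, rfl⟩

theorem height_pos_of_mem_posB {α : Fin r → ℝ} (hα : α ∈ posB r) : 0 < height α := by
  rcases hα with hD | ⟨a, rfl⟩
  · exact height_pos_of_mem_posD hD
  · exact height_e_pos a

theorem finite_posB : (posB r).Finite :=
  finite_posD.union ((finite_range e).subset fun _ ⟨a, ha⟩ => ⟨a, ha.symm⟩)

theorem isUniqueMaximal_posB (m : ℕ) :
    IsUniqueMaximal (posB (m + 3)) (posB (m + 3)) (e 0 + e 1) := by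
  refine ⟨Or.inl (isUniqueMaximal_posD m).1, ?_⟩
  rintro y (hD | ⟨a, rfl⟩) hne
  · obtain ⟨α, hα, hmem⟩ := (isUniqueMaximal_posD m).2 y hD hne
    exact ⟨α, Or.inl hα, Or.inl hmem⟩
  · obtain rfl | ha := eq_or_ne a 0
    · exact ⟨e 1, e_mem_posB 1, Or.inl (add_mem_posD Fin.zero_ne_one)⟩
    · refine ⟨e 0 - e a, Or.inl (sub_mem_posD (Fin.pos_iff_ne_zero.2 ha)), ?_⟩
      rw [add_sub_cancel]
      exact e_mem_posB 0

theorem dotProduct_self_of_mem_posD {α : Fin r → ℝ} (hα : α ∈ posD r) : α ⬝ᵥ α = 2 := by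
  obtain ⟨a, b, hab, u, hu, rfl⟩ := mem_posD_iff.1 hα
  exact dotProduct_self_add_smul hab hu

theorem finsum_mem_posB : ∑ᶠ α ∈ posB r, α = fun a : Fin r => 2 * ((r : ℝ) - 1 - a) + 1 := by
  have hunion : posB r = posD r ∪ range e := by
    simp only [posB, range, eq_comm]
  have hdisj : Disjoint (posD r) (range e) := disjoint_left.2 fun _ hα ⟨a, ha⟩ => by
    have := dotProduct_self_of_mem_posD hα
    rw [← ha, dotProduct_e, e_apply_self] at this
    norm_num at this
  have hsum : ∑ a : Fin r, (e a : Fin r → ℝ) = 1 := by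
    ext a
    simp only [Finset.sum_apply, e_apply, Finset.sum_ite_eq, Finset.mem_univ, if_true, Pi.one_apply]
  rw [hunion, finsum_mem_union hdisj finite_posD (finite_range e), finsum_mem_posD,
    finsum_mem_range e_injective, finsum_eq_sum_of_fintype, hsum]
  rfl

theorem apply_zero_of_mem_posB {m : ℕ} {α : Fin (m + 1) → ℝ} (hα : α ∈ posB (m + 1)) :
    α 0 = 0 ∨ α 0 = 1 := by
  rcases hα with hD | ⟨a, rfl⟩
  · obtain ⟨a, b, hab, u, -, rfl⟩ := mem_posD_iff.1 hD
    rw [Pi.add_apply, Pi.smul_apply, e_apply_of_ne (Fin.ne_zero_of_lt hab).symm, smul_zero,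
      add_zero, e_apply]
    exact (ite_eq_or_eq _ _ _).symm
  · rw [e_apply]
    exact (ite_eq_or_eq _ _ _).symm

theorem coordReflection_mem_posB_or {m : ℕ} {α : Fin (m + 1) → ℝ} (hα : α ∈ posB (m + 1)) :
    coordReflection 0 α ∈ posB (m + 1) ∨ -coordReflection 0 α ∈ posB (m + 1) := by
  rcases hα with hD | ⟨a, rfl⟩
  · obtain ⟨a, b, hab, u, hu, rfl⟩ := mem_posD_iff.1 hD
    have hb : coordReflection 0 (e b) = e b :=
      coordReflection_of_eq_zero (e_apply_of_ne (Fin.ne_zero_of_lt hab).symm)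
    obtain rfl | ha := eq_or_ne a 0
    · rw [map_add, map_smul, hb, coordReflection_e, ← neg_one_smul ℝ]
      exact (smul_add_smul_mem_posD_or hab.ne (Or.inr rfl) hu).imp Or.inl Or.inl
    · rw [map_add, map_smul, hb, coordReflection_of_eq_zero (e_apply_of_ne ha.symm)]
      exact Or.inl (Or.inl hD)
  · obtain rfl | ha := eq_or_ne a 0
    · rw [coordReflection_e, neg_neg]
      exact Or.inr (e_mem_posB 0)
    · rw [coordReflection_of_eq_zero (e_apply_of_ne ha.symm)]
      exact Or.inl (e_mem_posB a)

end Orthogonal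

section Simple

/-- The data with `𝔤♮` simple and all `(ε_a|ε_a)` equal to `c`; it covers `spo(2|2r)` and `F(4)`. -/
abbrev simpleData (n : ℕ) (c : ℝ) (pos halfWeights : Set (Fin n → ℝ)) (hDual : ℝ) (p : ℝ → ℝ)
    (rhoR : Set (Fin 1 × (Fin n → ℝ))) : RootData where
  n := n
  s := 1
  sq _ := c
  pos _ := pos
  halfWeights := halfWeights
  hDual := hDual
  p := p
  rhoR := rhoR

variable {n : ℕ} {c : ℝ} {pos halfWeights : Set (Fin n → ℝ)} {hDual : ℝ} {p : ℝ → ℝ}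
    {rhoR : Set (Fin 1 × (Fin n → ℝ))}

theorem simpleData_posR : (simpleData n c pos halfWeights hDual p rhoR).posR = pos := iUnion_const _

theorem simpleData_form (x y : Fin n → ℝ) :
    (simpleData n c pos halfWeights hDual p rhoR).form x y = c * (x ⬝ᵥ y) := by
  simp only [form, dotProduct, Finset.mul_sum, mul_assoc]

end Simple

section F4

/-- The data of `F(4)`, for an arbitrary list of Ramond weights. -/
noncomputable abbrev f4Data (rhoR : Set (Fin 1 × (Fin 3 → ℝ))) : RootData :=
  simpleData 3 (-2 / 3) (posB 3) (cube 3 (1 / 2)) (-2) (fun k => (k + 2 / 3) * (k - 2 / 3)) rhoR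

variable {rhoR : Set (Fin 1 × (Fin 3 → ℝ))}

theorem f4Data_isHighestData :
    (f4Data rhoR).IsHighestData (fun _ => e 0 + e 1) fun _ => 1 / 2 where
  sq_neg _ := by norm_num
  finite_pos _ := finite_posB
  height_pos _ _ := height_pos_of_mem_posB
  isUniqueMaximal_theta _ := by
    rw [simpleData_posR]
    exact isUniqueMaximal_posB 0
  finite_halfWeights := finite_cube
  neg_mem_halfWeights _ := neg_mem_cube
  isUniqueMaximal_lam := isUniqueMaximal_cube fun a => by
    rw [mul_one_div_cancel two_ne_zero, one_smul, simpleData_posR]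
    exact e_mem_posB a

theorem f4Data_form_e (x : Fin 3 → ℝ) : (f4Data rhoR).form x (e 0) = -2 / 3 * x 0 := by
  rw [simpleData_form, dotProduct_e]

theorem f4Data_form_theta :
    (f4Data rhoR).form (e 0 + e 1) (e 0 + e 1) = -4 / 3 := by
  rw [simpleData_form, dotProduct_self_of_mem_posD (add_mem_posD Fin.zero_ne_one)]
  norm_num

theorem f4Data_twoRho :
    (f4Data rhoR).twoRho (f4Data rhoR).posR = ![5, 3, 1] := by
  rw [simpleData_posR, twoRho, finsum_mem_posB]
  ext a
  fin_cases a <;> norm_num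

theorem f4Data_form_twoRho (x : Fin 3 → ℝ) :
    (f4Data rhoR).form ((f4Data rhoR).twoRho (f4Data rhoR).posR) x =
      -2 / 3 * (5 * x 0 + 3 * x 1 + x 2) := by
  rw [f4Data_twoRho, simpleData_form, Matrix.vec3_dotProduct]
  change -2 / 3 * (5 * x 0 + 3 * x 1 + 1 * x 2) = _
  rw [one_mul]

theorem exists_onCoroot_e_eq_of_mem_posB {α : Fin 3 → ℝ} (hα : α ∈ posB 3) :
    ∃ c : ℕ, (f4Data rhoR).onCoroot (e 0) α = c := by
  rw [onCoroot, form_comm, f4Data_form_e, simpleData_form]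
  rcases apply_zero_of_mem_posB hα with h0 | h1
  · exact ⟨0, by rw [h0, mul_zero, mul_zero, zero_div, Nat.cast_zero]⟩
  · rcases hα with hD | ⟨a, rfl⟩
    · exact ⟨1, by rw [h1, dotProduct_self_of_mem_posD hD]; norm_num⟩
    · exact ⟨2, by rw [h1, dotProduct_e, e_apply_self]; norm_num⟩

theorem f4Data_isSpectralFlow :
    (f4Data rhoR).IsSpectralFlow (fun _ => e 0 + e 1) (fun _ => 1 / 2) 0 (e 0)
      (coordReflection 0) 5 where
  toIsHighestData := f4Data_isHighestData
  involutive := coordReflection_involutive 0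
  form_map_map := form_coordReflection (R := f4Data rhoR) 0
  map_mem_roots _ _ := coordReflection_mem_posB_or
  map_mem_halfWeights _ := coordReflection_mem_cube 0
  map_mem_posR α hα h0 := by
    rw [f4Data_form_e, mul_eq_zero, or_iff_right (by norm_num)] at h0
    rwa [coordReflection_of_eq_zero h0]
  onCoroot_nat := by
    rw [simpleData_posR]
    exact fun _ => exists_onCoroot_e_eq_of_mem_posB
  form_pos α hα := by
    rw [f4Data_form_e, f4Data_form_theta]
    refine (apply_zero_of_mem_posB hα).imp (fun h0 => ?_) (fun h1 => ?_)
    · rw [h0, mul_zero]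
    · rw [h1]
      norm_num
  form_pos_ne j hj := absurd (Subsingleton.elim j 0) hj
  form_theta := by
    rw [f4Data_form_theta, f4Data_form_e, Pi.add_apply, e_apply_self, e_apply_of_ne zero_ne_one]
    norm_num
  form_halfWeights μ hμ := by
    rw [f4Data_form_theta, f4Data_form_e]
    refine (hμ 0).imp (fun h => ?_) (fun h => ?_) <;>
    · rw [h]
      norm_num
  map_twoRho := by
    rw [f4Data_twoRho, coordReflection_apply]
    norm_num
  form_twoRho_map := by
    rw [f4Data_form_twoRho, f4Data_form_theta, coordReflection_apply_self,
      coordReflection_apply_of_ne one_ne_zero,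
      coordReflection_apply_of_ne (show (2 : Fin 3) ≠ 0 by decide)]
    norm_num
  one_lt := by norm_num
  hDual_eq := by
    rw [f4Data_form_theta]
    norm_num
  p_eq k := by
    rw [f4Data_form_theta, f4Data_form_e, e_apply_self]
    ring

end F4

section SignedReversal

variable {n : ℕ}

/-- The isometry `ε_a ↦ -t_a t_{a*} ε_{a*}`, `a* = n - 1 - a`, attached to a vector `t` of signs;
it is the map `w` of `IsSpectralFlow` for `𝔤♮ = so(2n)` and `ρ_R = ½ ∑ t_a ε_a`. -/
def signedReversal (t : Fin n → ℝ) : (Fin n → ℝ) →ₗ[ℝ] Fin n → ℝ :=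
  -LinearMap.pi fun a => (t a * t a.rev) • LinearMap.proj a.rev

variable {t : Fin n → ℝ}

theorem signedReversal_apply (x : Fin n → ℝ) (a : Fin n) :
    signedReversal t x a = -(t a * t a.rev * x a.rev) := rfl

theorem signedReversal_e (a : Fin n) :
    signedReversal t (e a) = (-(t a * t a.rev)) • e a.rev := by
  ext b
  rw [signedReversal_apply, Pi.smul_apply, smul_eq_mul]
  obtain rfl | hb := eq_or_ne b a.rev
  · rw [Fin.rev_rev, e_apply_self, e_apply_self, mul_one, mul_one, mul_comm]
  · rw [e_apply_of_ne hb, e_apply_of_ne (mt Fin.rev_eq_iff.1 hb), mul_zero, mul_zero, neg_zero]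

theorem mul_self_eq_one (ht : ∀ a, t a = 1 ∨ t a = -1) (a : Fin n) : t a * t a = 1 :=
  mul_self_eq_one_iff.2 (ht a)

theorem neg_mul_eq_one_or (ht : ∀ a, t a = 1 ∨ t a = -1) (a b : Fin n) :
    -(t a * t b) = 1 ∨ -(t a * t b) = -1 := by
  rcases ht a with ha | ha <;> rcases ht b with hb | hb <;> norm_num [ha, hb]

theorem signedReversal_involutive (ht : ∀ a, t a = 1 ∨ t a = -1) :
    Involutive (signedReversal t) := fun x => by
  ext a
  rw [signedReversal_apply, signedReversal_apply, Fin.rev_rev]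
  linear_combination x a * (t a.rev * t a.rev * mul_self_eq_one ht a + mul_self_eq_one ht a.rev)

theorem dotProduct_signedReversal (ht : ∀ a, t a = 1 ∨ t a = -1) (x y : Fin n → ℝ) :
    signedReversal t x ⬝ᵥ signedReversal t y = x ⬝ᵥ y := by
  rw [dotProduct, dotProduct, ← Equiv.sum_comp Fin.revPerm fun a => x a * y a]
  refine Finset.sum_congr rfl fun a _ => ?_
  rw [signedReversal_apply, signedReversal_apply, Fin.revPerm_apply]
  linear_combination x a.rev * y a.rev *
    (t a.rev * t a.rev * mul_self_eq_one ht a + mul_self_eq_one ht a.rev)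

theorem signedReversal_mem_posD_or (ht : ∀ a, t a = 1 ∨ t a = -1) {α : Fin n → ℝ}
    (hα : α ∈ posD n) : signedReversal t α ∈ posD n ∨ -signedReversal t α ∈ posD n := by
  obtain ⟨a, b, hab, v, hv, rfl⟩ := mem_posD_iff.1 hα
  have hvt : v * -(t b * t b.rev) = 1 ∨ v * -(t b * t b.rev) = -1 := by
    rcases hv with rfl | rfl <;> rcases neg_mul_eq_one_or ht b b.rev with h | h <;> norm_num [h]
  rw [map_add, map_smul, signedReversal_e, signedReversal_e, smul_smul]
  exact smul_add_smul_mem_posD_or (Fin.rev_injective.ne hab.ne)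
    (neg_mul_eq_one_or ht a a.rev) hvt

end SignedReversal

section Spo

variable {m : ℕ}

/-- The data of `spo(2|2r)`, `r = m + 3`, for an arbitrary list of Ramond weights. -/
noncomputable abbrev spoData (m : ℕ) (rhoR : Set (Fin 1 × (Fin (m + 3) → ℝ))) : RootData :=
  simpleData (m + 3) (-1 / 2) (posD (m + 3)) {η | ∃ a, η = e a ∨ η = -e a} (2 - (m + 3 : ℕ))
    (fun k => (k + 1 / 2) * (k + (3 - (m + 3 : ℕ)) / 2)) rhoR

variable {rhoR : Set (Fin 1 × (Fin (m + 3) → ℝ))}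

theorem isUniqueMaximal_e_zero :
    IsUniqueMaximal (posD (m + 3)) {η | ∃ a, η = e a ∨ η = -e a} (e 0) := by
  refine ⟨⟨0, Or.inl rfl⟩, ?_⟩
  rintro _ ⟨a, rfl | rfl⟩ hne
  · have ha : 0 < a := Fin.pos_iff_ne_zero.2 fun h => hne (congrArg e h)
    exact ⟨e 0 - e a, sub_mem_posD ha, 0, Or.inl (add_sub_cancel _ _)⟩
  · obtain rfl | ha := eq_or_ne a 0
    · exact ⟨e 0 + e 1, add_mem_posD Fin.zero_ne_one, 1, Or.inl (neg_add_cancel_left _ _)⟩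
    · exact ⟨e a + e 0, add_mem_posD ha, 0, Or.inl (neg_add_cancel_left _ _)⟩

theorem spoData_isHighestData :
    (spoData m rhoR).IsHighestData (fun _ => e 0 + e 1) (e 0) where
  sq_neg _ := by norm_num
  finite_pos _ := finite_posD
  height_pos _ _ := height_pos_of_mem_posD
  isUniqueMaximal_theta _ := by
    rw [simpleData_posR]
    exact isUniqueMaximal_posD m
  finite_halfWeights := by
    refine ((finite_range e).union (finite_range (-e))).subset ?_
    rintro _ ⟨a, rfl | rfl⟩
    exacts [Or.inl ⟨a, rfl⟩, Or.inr ⟨a, rfl⟩]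
  neg_mem_halfWeights := by
    rintro _ ⟨a, rfl | rfl⟩
    exacts [⟨a, Or.inr rfl⟩, ⟨a, Or.inl (neg_neg _)⟩]
  isUniqueMaximal_lam := by
    rw [simpleData_posR]
    exact isUniqueMaximal_e_zero

theorem spoData_twoRho :
    (spoData m rhoR).twoRho (spoData m rhoR).posR =
      fun a : Fin (m + 3) => 2 * (((m + 3 : ℕ) : ℝ) - 1 - a) := by
  rw [simpleData_posR, twoRho, finsum_mem_posD]

theorem spoData_form_theta : (spoData m rhoR).form (e 0 + e 1) (e 0 + e 1) = -1 := by
  rw [simpleData_form, dotProduct_self_of_mem_posD (add_mem_posD Fin.zero_ne_one)]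
  norm_num

variable {t : Fin (m + 3) → ℝ}

theorem spoData_form_smul (x : Fin (m + 3) → ℝ) :
    (spoData m rhoR).form x ((1 / 2 : ℝ) • t) = -1 / 4 * (x ⬝ᵥ t) := by
  rw [simpleData_form, dotProduct_smul, smul_eq_mul]
  ring

theorem add_smul_dotProduct (ht : ∀ a, a ≠ Fin.last (m + 2) → t a = 1) {a b : Fin (m + 3)}
    (hab : a < b) (v : ℝ) : (e a + v • e b) ⬝ᵥ t = 1 + v * t b := by
  rw [add_dotProduct, smul_dotProduct, dotProduct_comm, dotProduct_e, dotProduct_comm,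
    dotProduct_e, ht a (Fin.ne_last_of_lt hab), smul_eq_mul]

theorem dotProduct_eq_zero_or_two_of_mem_posD (hsign : ∀ a, t a = 1 ∨ t a = -1)
    (ht : ∀ a, a ≠ Fin.last (m + 2) → t a = 1) {α : Fin (m + 3) → ℝ} (hα : α ∈ posD (m + 3)) :
    α ⬝ᵥ t = 0 ∨ α ⬝ᵥ t = 2 := by
  obtain ⟨a, b, hab, v, hv, rfl⟩ := mem_posD_iff.1 hα
  rw [add_smul_dotProduct ht hab]
  rcases hv with rfl | rfl <;> rcases hsign b with hb | hb <;> norm_num [hb]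

theorem signedReversal_mem_posD (hsign : ∀ a, t a = 1 ∨ t a = -1)
    (ht : ∀ a, a ≠ Fin.last (m + 2) → t a = 1) {α : Fin (m + 3) → ℝ} (hα : α ∈ posD (m + 3))
    (h0 : α ⬝ᵥ t = 0) : signedReversal t α ∈ posD (m + 3) := by
  obtain ⟨a, b, hab, v, -, rfl⟩ := mem_posD_iff.1 hα
  rw [add_smul_dotProduct ht hab] at h0
  have hrev : b.rev < a.rev := Fin.rev_lt_rev.2 hab
  refine mem_posD_iff.2 ⟨b.rev, a.rev, hrev, -t a.rev, ?_, ?_⟩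
  · exact (hsign a.rev).symm.imp (fun h => by rw [h, neg_neg]) (congrArg Neg.neg)
  · rw [map_add, map_smul, signedReversal_e, signedReversal_e, smul_smul,
      ht a (Fin.ne_last_of_lt hab), ht b.rev (Fin.ne_last_of_lt hrev), one_mul, mul_one, mul_neg,
      ← eq_neg_of_add_eq_zero_left h0, one_smul]
    exact add_comm _ _

theorem signedReversal_twoRho (ht : ∀ a, a ≠ Fin.last (m + 2) → t a = 1) :
    signedReversal t (fun a => 2 * (((m + 3 : ℕ) : ℝ) - 1 - a)) =
      (fun a : Fin (m + 3) => 2 * (((m + 3 : ℕ) : ℝ) - 1 - a)) -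
        (2 * (2 * (m + 2) : ℝ)) • (1 / 2 : ℝ) • t := by
  have hrev (a : Fin (m + 3)) : ((a.rev : ℕ) : ℝ) = m + 2 - a := by
    rw [Fin.val_rev, Nat.cast_sub a.isLt]
    push_cast
    ring
  ext a
  simp only [signedReversal_apply, Pi.sub_apply, Pi.smul_apply, smul_eq_mul, hrev]
  push_cast
  obtain rfl | ha := eq_or_ne a (Fin.last (m + 2))
  · rw [Fin.rev_last, ht 0 (Fin.last_pos).ne, Fin.val_last]
    push_cast
    ring
  · rw [ht a ha]
    obtain rfl | ha0 := eq_or_ne a 0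
    · rw [Fin.val_zero]
      push_cast
      ring
    · rw [ht a.rev fun h => ha0 (by rw [← Fin.rev_rev a, h, Fin.rev_last])]
      ring

theorem spoData_exists_onCoroot_eq (hsign : ∀ a, t a = 1 ∨ t a = -1)
    (ht : ∀ a, a ≠ Fin.last (m + 2) → t a = 1) {α : Fin (m + 3) → ℝ} (hα : α ∈ posD (m + 3)) :
    ∃ c : ℕ, (spoData m rhoR).onCoroot ((1 / 2 : ℝ) • t) α = c := by
  rw [onCoroot, form_comm, spoData_form_smul, simpleData_form, dotProduct_self_of_mem_posD hα]
  rcases dotProduct_eq_zero_or_two_of_mem_posD hsign ht hα with h | h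
  · exact ⟨0, by rw [h]; norm_num⟩
  · exact ⟨1, by rw [h]; norm_num⟩

theorem spoData_isSpectralFlow (hsign : ∀ a, t a = 1 ∨ t a = -1)
    (ht : ∀ a, a ≠ Fin.last (m + 2) → t a = 1) :
    (spoData m rhoR).IsSpectralFlow (fun _ => e 0 + e 1) (e 0) 0 ((1 / 2 : ℝ) • t)
      (signedReversal t) (2 * (m + 2)) where
  toIsHighestData := spoData_isHighestData
  involutive := signedReversal_involutive hsign
  form_map_map x y := by
    rw [simpleData_form, simpleData_form, dotProduct_signedReversal hsign]
  map_mem_roots _ _ := signedReversal_mem_posD_or hsign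
  map_mem_halfWeights := by
    have he (a : Fin (m + 3)) :
        signedReversal t (e a) = e a.rev ∨ signedReversal t (e a) = -e a.rev := by
      rw [signedReversal_e]
      refine (neg_mul_eq_one_or hsign a a.rev).imp (fun h => ?_) (fun h => ?_)
      · rw [h, one_smul]
      · rw [h, neg_one_smul]
    rintro _ ⟨a, rfl | rfl⟩
    · exact ⟨a.rev, he a⟩
    · rw [map_neg]
      exact ⟨a.rev, (he a).symm.imp neg_eq_iff_eq_neg.2 (congrArg Neg.neg)⟩
  map_mem_posR α hα h0 := by
    rw [simpleData_posR] at hα ⊢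
    rw [spoData_form_smul, mul_eq_zero, or_iff_right (by norm_num)] at h0
    exact signedReversal_mem_posD hsign ht hα h0
  onCoroot_nat := by
    rw [simpleData_posR]
    exact fun _ => spoData_exists_onCoroot_eq hsign ht
  form_pos α hα := by
    rw [spoData_form_smul, spoData_form_theta]
    refine (dotProduct_eq_zero_or_two_of_mem_posD hsign ht hα).imp (fun h => ?_) (fun h => ?_) <;>
    · rw [h]
      norm_num
  form_pos_ne j hj := absurd (Subsingleton.elim j 0) hj
  form_theta := by
    have h01 := add_smul_dotProduct ht (Fin.zero_lt_one (n := m + 1)) 1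
    rw [one_smul, ht 1 (by simp [Fin.ext_iff])] at h01
    rw [spoData_form_theta, spoData_form_smul, h01]
    norm_num
  form_halfWeights := by
    have he (a : Fin (m + 3)) : (spoData m rhoR).form (e a) ((1 / 2 : ℝ) • t) = -1 / 4 * t a := by
      rw [spoData_form_smul, dotProduct_comm, dotProduct_e]
    rintro _ ⟨a, rfl | rfl⟩ <;> rw [spoData_form_theta]
    · rw [he]
      rcases hsign a with h | h <;> norm_num [h]
    · rw [form_neg_left, he]
      rcases hsign a with h | h <;> norm_num [h]
  map_twoRho := by
    rw [spoData_twoRho, signedReversal_twoRho ht]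
  form_twoRho_map := by
    rw [spoData_twoRho, spoData_form_theta, signedReversal_e, simpleData_form, dotProduct_smul,
      dotProduct_e, Fin.rev_zero, Fin.val_last]
    push_cast
    ring
  one_lt := by
    have : (0 : ℝ) ≤ m := m.cast_nonneg
    linarith
  hDual_eq := by
    rw [spoData_form_theta]
    push_cast
    ring
  p_eq k := by
    have hsq : t ⬝ᵥ t = (m + 3 : ℕ) := by
      simp [dotProduct, mul_self_eq_one hsign]
    rw [spoData_form_theta, spoData_form_smul, smul_dotProduct, hsq, smul_eq_mul]
    ring

/-- The signs `t` for which `½ ∑ t_a ε_a` is the weight `ω_r` (`u = 1`) or `ω_{r-1}` (`u = -1`). -/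
def lastSign (m : ℕ) (u : ℝ) : Fin (m + 3) → ℝ := update 1 (Fin.last (m + 2)) u

theorem spoData_isSpectralFlow_lastSign {u : ℝ} (hu : u = 1 ∨ u = -1) :
    (spoData m rhoR).IsSpectralFlow (fun _ => e 0 + e 1) (e 0) 0 ((1 / 2 : ℝ) • lastSign m u)
      (signedReversal (lastSign m u)) (2 * (m + 2)) := by
  refine spoData_isSpectralFlow (fun a => ?_) fun a ha => update_of_ne ha _ _
  obtain rfl | ha := eq_or_ne a (Fin.last (m + 2))
  · rwa [lastSign, update_self]
  · exact Or.inl (update_of_ne ha _ _)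

end Spo

namespace Superalgebra

theorem psl22_data : psl22.data =
    sl2Power 1 (fun _ => -1 / 2) (fun k => k * (k + 1)) {(0, e 0)} := by
  have hpos : (fun _ : Fin 1 => ({(2 : ℝ) • e 0} : Set (Fin 1 → ℝ))) = fun j => {(2 : ℝ) • e j} :=
    funext fun j => by rw [Subsingleton.elim j 0]
  have hhalf : ({e 0, -e 0} : Set (Fin 1 → ℝ)) = cube 1 1 := by
    ext x
    simp [cube, funext_iff, e_apply]
  rw [data, hpos, hhalf]

theorem D21_data (m n : ℕ) (hm : 0 < m) (hn : 0 < n) (hmn : m.Coprime n) :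
    (D21 m n hm hn hmn).data = d21Data m n {(0, e 0), (1, e 1)} := by
  have hhalf : ({e 0 + e 1, e 0 - e 1, -e 0 + e 1, -e 0 - e 1} : Set (Fin 2 → ℝ)) = cube 2 1 := by
    ext x
    simp [cube, funext_iff, e_apply, Fin.forall_fin_two]
    tauto
  rw [data, hhalf]

theorem F4_data : F4.data = f4Data {(0, e 0)} := by
  have hhalf : {η : Fin 3 → ℝ | ∀ a, η a = 1 / 2 ∨ η a = -1 / 2} = cube 3 (1 / 2) := by
    simp only [cube, neg_div]
  rw [data, hhalf]

theorem spo_data (m : ℕ) (hr : 3 ≤ m + 3) : (spo (m + 3) hr).data =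
    spoData m {(0, (1 / 2 : ℝ) • lastSign m 1), (0, (1 / 2 : ℝ) • lastSign m (-1))} := by
  have hone : (1 / 2 : ℝ) • lastSign m 1 = fun _ => 1 / 2 := by
    rw [show lastSign m 1 = 1 from update_eq_self _ _]
    exact funext fun _ => mul_one _
  have hneg : (1 / 2 : ℝ) • lastSign m (-1) = (fun _ => 1 / 2) - e (Fin.last (m + 2)) := by
    ext a
    simp only [lastSign, Pi.smul_apply, Pi.sub_apply, e_apply, update_apply, Pi.one_apply]
    split_ifs <;> norm_num
  rw [hone, hneg]
  rfl

theorem exists_isSpectralFlow (g : Superalgebra) {i : Fin g.data.s} {ρ : Fin g.data.n → ℝ}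
    (hρ : (i, ρ) ∈ g.data.rhoR) : ∃ θ lam w h, g.data.IsSpectralFlow θ lam i ρ w h := by
  revert i ρ
  cases g with
  | psl22 =>
    rw [psl22_data]
    rintro i ρ ⟨⟩
    refine ⟨_, _, _, _, sl2Power_isSpectralFlow (fun _ => by norm_num) (by norm_num) _ fun k => ?_⟩
    ring
  | spo r hr =>
    obtain ⟨m, rfl⟩ := Nat.exists_eq_add_of_le' hr
    rw [spo_data]
    simp only [mem_insert_iff, mem_singleton_iff, Prod.mk.injEq]
    rintro i ρ (⟨rfl, rfl⟩ | ⟨rfl, rfl⟩)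
    · exact ⟨_, _, _, _, spoData_isSpectralFlow_lastSign (Or.inl rfl)⟩
    · exact ⟨_, _, _, _, spoData_isSpectralFlow_lastSign (Or.inr rfl)⟩
  | D21 m n hm hn hmn =>
    rw [D21_data]
    simp only [mem_insert_iff, mem_singleton_iff, Prod.mk.injEq]
    rintro i ρ (⟨rfl, rfl⟩ | ⟨rfl, rfl⟩) <;>
      exact ⟨_, _, _, _, d21Data_isSpectralFlow hm hn _⟩
  | F4 =>
    rw [F4_data]
    rintro i ρ ⟨⟩
    exact ⟨_, _, _, _, f4Data_isSpectralFlow⟩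

end Superalgebra

end MinimalW

theorem mainTheorem5_general (g : MinimalW.Superalgebra) (k : ℝ) (i : Fin g.data.s)
    (hk : ∃ N : ℕ, g.data.M i k = N) (ρR : Fin g.data.n → ℝ) (hρR : (i, ρR) ∈ g.data.rhoR)
    (ν : Fin g.data.n → ℝ) :
    (ν ∈ g.data.PNS i ρR k ↔ ν + g.data.M i k • ρR ∈ g.data.PR k) ∧
    g.data.ANS i ρR k ν
        + 2 / g.data.form (g.data.theta i) (g.data.theta i) * g.data.form ν ρR
        + 1 / g.data.form (g.data.theta i) (g.data.theta i) * g.data.M i k * g.data.form ρR ρR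
      = g.data.AR i ρR k (ν + g.data.M i k • ρR) := by
  obtain ⟨N, hN⟩ := hk
  obtain ⟨θ, lam, w, h, S⟩ := g.exists_isSpectralFlow hρR
  exact ⟨S.mem_PNS_iff_add_smul_mem_PR hN, S.ANS_add_eq_AR (hN ▸ N.cast_nonneg) ν⟩

theorem mainTheorem5 (g : MinimalW.Superalgebra) (k : ℝ)
    (hk : ∀ j, ∃ N : ℕ, g.data.M j k = N)
    (i : Fin g.data.s) (ρR : Fin g.data.n → ℝ) (hρR : (i, ρR) ∈ g.data.rhoR)
    (ν : Fin g.data.n → ℝ) (hν : ν ∈ g.data.PNS i ρR k) :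
    ν + g.data.M i k • ρR ∈ g.data.PR k ∧
    g.data.ANS i ρR k ν
        + 2 / g.data.form (g.data.theta i) (g.data.theta i) * g.data.form ν ρR
        + 1 / g.data.form (g.data.theta i) (g.data.theta i) * g.data.M i k * g.data.form ρR ρR
      = g.data.AR i ρR k (ν + g.data.M i k • ρR) :=
  have h := mainTheorem5_general g k i (hk i) ρR hρR ν
  ⟨h.1.1 hν, h.2⟩
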